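/- Let $k$ be an algebraically closed field of characteristic $0$ and $V$ a finite-dimensional $k$-vector space. Let $\mathcal E$ be a set of polynomial maps $V\to V$ that is a $k$-linear subspace of the space of all polynomial maps, is closed under composition and contains $\mathrm{id}_V$. For $x\in V$ let $\mathcal E(x)=\{\varphi(x)\mid\varphi\in\mathcal E\}$, a linear subspace of $V$. Let $X\subset V$ be an irreducible Zariski-closed subvariety with $\varphi(X)\subset X$ for all $\varphi\in\mathcal E$. Put $d(X)=\max_{x\in X}\dim\mathcal E(x)$ and $X'=\{x\in X\mid\dim\mathcal E(x)=d(X)\}$, and consider the map $$\pi\colon X'\to \mathrm{Gr}_{d(X)}(V),\qquad x\mapsto\mathcal E(x),$$ into the Grassmannian of $d(X)$-dimensional subspaces of $V$, a projective variety via the Plücker embedding. Each $\varphi\in\mathcal E$ defines the vector field $\xi_\varphi$ on $V$ with $\xi_\varphi(v)=\varphi(v)\in V=T_vV$ (in coordinates $\xi_\varphi=\sum_i\varphi_i\,\partial/\partial x_i$); since $X$ is $\mathcal E$-stable, $\xi_\varphi$ restricts to a derivation of the coordinate ring $\mathcal O(X)$ and extends to the field $k(X)$ of rational functions. The field of first integrals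 is $$\mathcal F=\{f\in k(X)\mid \xi_\varphi f=0\text{ for all }\varphi\in\mathcal E\}.$$ The dimension of an irreducible variety is the transcendence degree over $k$ of its field of rational functions. Then: 1. For every $x\in X'$ we have $\pi^{-1}(\pi(x))=\mathcal E(x)\cap X'$. 2. The closure $\overline{\pi(X')}\subset\mathrm{Gr}_{d(X)}(V)$ is irreducible, and pulling back rational functions along $\pi$ gives an isomorphism of $k$-algebras $\pi^*\colon k(\overline{\pi(X')})\to\mathcal F$; if $r\in k(\overline{\pi(X')})$ is defined at $\pi(x)$, where $x\in X'$, then $\pi^*r$ is defined at $x$ and $(\pi^*r)(x)=r(\pi(x))$. 3. $\operatorname{trdeg}_k\mathcal F=\dim X-d(X)=\dim\overline{\pi(X')}$. 4. $\mathcal F=k$ if and only if $d(X)=\dim X$, and in this case $X$ is a linear subspace of $V$. -/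

import Mathlib

open scoped LinearAlgebra.Projectivization Polynomial Topology

noncomputable section

namespace LinSemi

/-! ### Regular functions, polynomial endomorphisms and the Zariski topology of a vector space -/

section Affine

variable (k : Type*) {V : Type*} [Field k] [AddCommGroup V] [Module k V]

variable (V) in
/-- The algebra `O(V)` of regular (polynomial) functions on the vector space `V`: the algebra of
functions generated by the linear functionals. -/
def regFun : Subalgebra k (V → k) :=
  Algebra.adjoin k (Set.range fun l : Module.Dual k V => (l : V → k))

/-- `φ : V → V` is a morphism of varieties, i.e. a polynomial endomorphism: each of its
coordinates is a regular function. -/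
def IsPolyMap (φ : V → V) : Prop :=
  ∀ l : Module.Dual k V, (fun v => l (φ v)) ∈ regFun k V

variable (V) in
/-- The Zariski topology on `V`: the sets `{f ≠ 0}` for `f` regular form a basis of open sets. -/
abbrev zariski : TopologicalSpace V :=
  TopologicalSpace.generateFrom {U | ∃ f ∈ regFun k V, U = {v | f v ≠ 0}}

/-- Restriction of functions on `V` to a subset. -/
def restrictHom (S : Set V) : (V → k) →ₐ[k] (S → k) where
  toFun f x := f x
  map_one' := rfl
  map_mul' _ _ := rfl
  map_zero' := rfl
  map_add' _ _ := rfl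
  commutes' _ := rfl

/-- The algebra of the functions on `S ⊆ V` which are restrictions of regular functions on `V`. -/
def coordAlg (S : Set V) : Subalgebra k (S → k) :=
  (regFun k V).map (restrictHom k S)

/-- The coordinate ring of `S ⊆ V`: the restrictions to `S` of the regular functions on `V`. -/
def CoordRing (S : Set V) : Type _ := coordAlg k S

instance (S : Set V) : CommRing (CoordRing k S) := inferInstanceAs (CommRing (coordAlg k S))

instance (S : Set V) : Algebra k (CoordRing k S) := inferInstanceAs (Algebra k (coordAlg k S))

/-- The restriction map `O(V) → O(S)`. -/
def restr (S : Set V) : regFun k V →ₐ[k] CoordRing k S :=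
  show regFun k V →ₐ[k] coordAlg k S from
    ((restrictHom k S).comp (regFun k V).val).codRestrict _ fun f => ⟨f, f.2, rfl⟩

variable {k} in
/-- Evaluation of elements of the coordinate ring at a point of `S`. -/
def evalAt {S : Set V} (x : S) : CoordRing k S →ₐ[k] k :=
  show coordAlg k S →ₐ[k] k from (Pi.evalAlgHom k (fun _ : S => k) x).comp (coordAlg k S).val

theorem restr_surjective (S : Set V) : Function.Surjective (restr k S) := by
  rintro ⟨_, f, hf, rfl⟩
  exact ⟨⟨f, hf⟩, rfl⟩

variable {k} in
theorem evalAt_restr {S : Set V} (x : S) (f : regFun k V) : evalAt x (restr k S f) = f.1 x := rfl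

variable {k} in
theorem coordRing_ext {S : Set V} {f g : CoordRing k S} (h : ∀ x, evalAt x f = evalAt x g) :
    f = g :=
  Subtype.ext (funext h)

/-- The directional derivative at `v` in the direction `w` of a regular function `f`: the
derivative at `t = 0` of the polynomial `p(t) = f (v + t w)`. -/
def dirDeriv (f : V → k) (v w : V) : k := by
  classical
  exact if h : ∃ p : k[X], ∀ t, p.eval t = f (v + t • w) then h.choose.derivative.eval 0 else 0

variable {k}

theorem exists_poly {f : V → k} (hf : f ∈ regFun k V) (v w : V) :
    ∃ p : k[X], ∀ t, p.eval t = f (v + t • w) := by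
  induction hf using Algebra.adjoin_induction with
  | mem f hf =>
    obtain ⟨l, rfl⟩ := hf
    exact ⟨Polynomial.C (l v) + Polynomial.X * Polynomial.C (l w), fun t => by simp [mul_comm t]⟩
  | algebraMap r => exact ⟨Polynomial.C r, fun t => by simp⟩
  | add f g _ _ hf hg =>
    obtain ⟨p, hp⟩ := hf
    obtain ⟨q, hq⟩ := hg
    exact ⟨p + q, fun t => by simp [hp, hq]⟩
  | mul f g _ _ hf hg =>
    obtain ⟨p, hp⟩ := hf
    obtain ⟨q, hq⟩ := hg
    exact ⟨p * q, fun t => by simp [hp, hq]⟩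

section Infinite

variable [Infinite k]

theorem dirDeriv_eq {f : V → k} {v w : V} {p : k[X]} (hp : ∀ t, p.eval t = f (v + t • w)) :
    dirDeriv k f v w = p.derivative.eval 0 := by
  have h : ∃ p : k[X], ∀ t, p.eval t = f (v + t • w) := ⟨p, hp⟩
  have h2 : h.choose = p := Polynomial.funext fun t => by rw [h.choose_spec, hp]
  simp only [dirDeriv, dif_pos h, h2]

theorem dirDeriv_algebraMap (r : k) (v w : V) :
    dirDeriv k (algebraMap k (V → k) r) v w = 0 := by
  rw [dirDeriv_eq (p := Polynomial.C r) (fun t => by simp)]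
  simp

theorem dirDeriv_linear (l : Module.Dual k V) (v w : V) : dirDeriv k l v w = l w := by
  rw [dirDeriv_eq (p := Polynomial.C (l v) + Polynomial.X * Polynomial.C (l w))
    (fun t => by simp [mul_comm t])]
  simp

theorem dirDeriv_add {f g : V → k} (hf : f ∈ regFun k V) (hg : g ∈ regFun k V) (v w : V) :
    dirDeriv k (f + g) v w = dirDeriv k f v w + dirDeriv k g v w := by
  obtain ⟨p, hp⟩ := exists_poly hf v w
  obtain ⟨q, hq⟩ := exists_poly hg v w
  rw [dirDeriv_eq hp, dirDeriv_eq hq, dirDeriv_eq (p := p + q) (fun t => by simp [hp, hq])]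
  simp

theorem dirDeriv_mul {f g : V → k} (hf : f ∈ regFun k V) (hg : g ∈ regFun k V) (v w : V) :
    dirDeriv k (f * g) v w = f v * dirDeriv k g v w + g v * dirDeriv k f v w := by
  obtain ⟨p, hp⟩ := exists_poly hf v w
  obtain ⟨q, hq⟩ := exists_poly hg v w
  rw [dirDeriv_eq hp, dirDeriv_eq hq, dirDeriv_eq (p := p * q) (fun t => by simp [hp, hq])]
  have h1 := hp 0
  have h2 := hq 0
  simp only [zero_smul, add_zero] at h1 h2
  simp [h1, h2]
  ring

theorem dirDeriv_mem {f : V → k} (hf : f ∈ regFun k V) {φ : V → V} (hφ : IsPolyMap k φ) :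
    (fun v => dirDeriv k f v (φ v)) ∈ regFun k V := by
  induction hf using Algebra.adjoin_induction with
  | mem f hf =>
    obtain ⟨l, rfl⟩ := hf
    simpa only [dirDeriv_linear] using hφ l
  | algebraMap r =>
    simp only [dirDeriv_algebraMap]
    exact (regFun k V).zero_mem
  | add f g hf hg h1 h2 =>
    simp only [dirDeriv_add hf hg]
    exact (regFun k V).add_mem h1 h2
  | mul f g hf hg h1 h2 =>
    simp only [dirDeriv_mul hf hg]
    exact (regFun k V).add_mem ((regFun k V).mul_mem hf h2) ((regFun k V).mul_mem hg h1)

/-- The algebraic vector field `ξ_φ` on `V` attached to a polynomial endomorphism `φ`, as a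
derivation of `O(V)`: `(ξ_φ f)(v)` is the derivative of `f` at `v` in the direction `φ v`
(in coordinates, `ξ_φ = ∑ φᵢ ∂/∂xᵢ`). -/
def vectorField (φ : V → V) (hφ : IsPolyMap k φ) : Derivation k (regFun k V) (regFun k V) :=
  Derivation.mk'
    { toFun := fun f => ⟨fun v => dirDeriv k f v (φ v), dirDeriv_mem f.2 hφ⟩
      map_add' := fun f g => Subtype.ext (funext fun v => dirDeriv_add f.2 g.2 v (φ v))
      map_smul' := fun r f => Subtype.ext (funext fun v => by
        have := dirDeriv_mul ((regFun k V).algebraMap_mem r) f.2 v (φ v)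
        rw [dirDeriv_algebraMap] at this
        simpa [Algebra.smul_def] using this) }
    (fun f g => Subtype.ext (funext fun v => dirDeriv_mul f.2 g.2 v (φ v)))

end Infinite

end Affine

/-! ### Extension of derivations to the field of fractions -/

section Fractions

variable {k A : Type*} (K : Type*) [Field k] [CommRing A] [Algebra k A] [Field K] [Algebra A K]
  [IsFractionRing A K] [Algebra k K] [IsScalarTower k A K]

/-- The homomorphism `a/b ↦ a/b + ε D(a/b)` from `K = Frac A` to the dual numbers over `K`. -/
def dualLift (D : Derivation k A A) :
    K →ₐ[k] TrivSqZeroExt K K :=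
  IsLocalization.liftAlgHom (M := nonZeroDivisors A)
    (f := ({ toFun := fun a => TrivSqZeroExt.inl (algebraMap A K a) +
                TrivSqZeroExt.inr (algebraMap A K (D a))
             map_one' := by ext <;> simp
             map_mul' := fun a b => by
              ext
              · simp
              · simp only [TrivSqZeroExt.snd_add, TrivSqZeroExt.snd_inl, TrivSqZeroExt.snd_inr,
                  zero_add, TrivSqZeroExt.snd_mul, TrivSqZeroExt.fst_add, TrivSqZeroExt.fst_inl,
                  TrivSqZeroExt.fst_inr, add_zero, Derivation.leibniz, map_add, smul_eq_mul,
                  map_mul, MulOpposite.smul_eq_mul_unop, MulOpposite.unop_op]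
                ring
             map_zero' := by ext <;> simp
             map_add' := fun a b => by
              ext
              · simp
              · simp only [TrivSqZeroExt.snd_add, TrivSqZeroExt.snd_inl,
                  TrivSqZeroExt.snd_inr, zero_add, map_add]
             commutes' := fun r => by
              ext
              · simp [TrivSqZeroExt.algebraMap_eq_inl', ← IsScalarTower.algebraMap_apply]
              · simp [TrivSqZeroExt.algebraMap_eq_inl'] } :
              A →ₐ[k] TrivSqZeroExt K K))
    (fun y => by
      rw [TrivSqZeroExt.isUnit_iff_isUnit_fst]
      have := IsLocalization.map_units K y
      simpa using this)

theorem dualLift_algebraMap (D : Derivation k A A) (a : A) :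
    dualLift K D (algebraMap A _ a) = TrivSqZeroExt.inl (algebraMap A K a) +
      TrivSqZeroExt.inr (algebraMap A K (D a)) := by
  simp [dualLift]

theorem fst_dualLift (D : Derivation k A A) (x : K) : (dualLift K D x).fst = x := by
  have : ((TrivSqZeroExt.fstHom k K K).comp (dualLift K D)) =
      AlgHom.id k _ := by
    apply IsLocalization.algHom_ext (nonZeroDivisors A)
    ext a
    change (dualLift K D (algebraMap A K a)).fst = algebraMap A K a
    rw [dualLift_algebraMap]
    simp
  exact DFunLike.congr_fun this x

/-- The unique extension of a derivation of the domain `A` to its field of fractions. -/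
def fracDeriv (D : Derivation k A A) : Derivation k K K :=
  Derivation.mk'
    ((TrivSqZeroExt.sndHom K K).restrictScalars k ∘ₗ
      (dualLift K D).toLinearMap)
    (fun x y => by
      simp [fst_dualLift, mul_comm])

theorem fracDeriv_algebraMap (D : Derivation k A A) (a : A) :
    fracDeriv K D (algebraMap A _ a) = algebraMap A _ (D a) := by
  change (dualLift K D (algebraMap A _ a)).snd = _
  rw [dualLift_algebraMap]
  simp only [TrivSqZeroExt.snd_add, TrivSqZeroExt.snd_inl, TrivSqZeroExt.snd_inr, zero_add]

end Fractions

/-! ### Irreducible closed subvarieties and their rational functions -/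

section Varieties

variable (k V : Type*) [Field k] [AddCommGroup V] [Module k V]

/-- An irreducible (Zariski-)closed subvariety of `V`. -/
structure IrredSubvariety where
  carrier : Set V
  isClosed : IsClosed[zariski k V] carrier
  isIrreducible : @IsIrreducible V (zariski k V) carrier

variable {k V}

/-- The coordinate ring `O(X)`. -/
abbrev IrredSubvariety.coordRing (X : IrredSubvariety k V) : Type _ := CoordRing k X.carrier

instance (X : IrredSubvariety k V) : IsDomain X.coordRing := by
  let := zariski k V
  obtain ⟨x, hx⟩ := X.isIrreducible.nonempty
  have : Nontrivial X.coordRing :=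
    ⟨0, 1, fun h => by simpa using congrArg (evalAt ⟨x, hx⟩) h⟩
  have : NoZeroDivisors X.coordRing := by
    refine ⟨fun {a b} hab => ?_⟩
    obtain ⟨f, rfl⟩ := restr_surjective k _ a
    obtain ⟨g, rfl⟩ := restr_surjective k _ b
    by_contra! hne
    have key : ∀ h : regFun k V, restr k X.carrier h ≠ 0 →
        (X.carrier ∩ {v | h.1 v ≠ 0}).Nonempty := by
      intro h hh
      by_contra hemp
      refine hh (coordRing_ext fun y => ?_)
      rw [evalAt_restr, map_zero]
      by_contra hy
      exact hemp ⟨y, y.2, hy⟩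
    have hopen : ∀ h : regFun k V, IsOpen {v | h.1 v ≠ 0} := fun h =>
      TopologicalSpace.isOpen_generateFrom_of_mem ⟨h.1, h.2, rfl⟩
    obtain ⟨y, hy, hy1, hy2⟩ := X.isIrreducible.isPreirreducible _ _ (hopen f) (hopen g)
      (key f hne.1) (key g hne.2)
    have h0 := congrArg (evalAt ⟨y, hy⟩) hab
    rw [map_mul, evalAt_restr, evalAt_restr, map_zero] at h0
    exact (mul_ne_zero hy1 hy2) h0
  exact NoZeroDivisors.to_isDomain _

/-- The field `k(X)` of rational functions on `X`, the field of fractions of `O(X)`. -/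
def IrredSubvariety.functionField (X : IrredSubvariety k V) : Type _ :=
  FractionRing X.coordRing

instance (X : IrredSubvariety k V) : Field X.functionField :=
  inferInstanceAs (Field (FractionRing X.coordRing))

instance (X : IrredSubvariety k V) : Algebra X.coordRing X.functionField :=
  inferInstanceAs (Algebra X.coordRing (FractionRing X.coordRing))

instance (X : IrredSubvariety k V) : Algebra k X.functionField :=
  inferInstanceAs (Algebra k (FractionRing X.coordRing))

instance (X : IrredSubvariety k V) : IsScalarTower k X.coordRing X.functionField :=
  inferInstanceAs (IsScalarTower k X.coordRing (FractionRing X.coordRing))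

instance (X : IrredSubvariety k V) : IsFractionRing X.coordRing X.functionField :=
  inferInstanceAs (IsFractionRing X.coordRing (FractionRing X.coordRing))

/-- The dimension of `X`: the transcendence degree over `k` of its field of rational functions. -/
def IrredSubvariety.dim (X : IrredSubvariety k V) : Cardinal :=
  Algebra.trdeg k X.functionField

/-- The rational function `r ∈ k(X)` is defined at the point `x` of `X` and takes the value `c`
there. -/
def IrredSubvariety.HasValueAt (X : IrredSubvariety k V) (r : X.functionField) (x : X.carrier)
    (c : k) : Prop :=
  ∃ a b : X.coordRing, evalAt x b ≠ 0 ∧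
    r * algebraMap X.coordRing X.functionField b = algebraMap X.coordRing X.functionField a ∧
    c = evalAt x a / evalAt x b

end Varieties

/-! ### Projective varieties -/

section Projective

variable (k : Type*) {W : Type*} [Field k] [AddCommGroup W] [Module k W]

/-- `f` is a homogeneous polynomial function of degree `m` on `W` (over an infinite field). -/
def IsHomog (m : ℕ) (f : regFun k W) : Prop :=
  ∀ (c : k) (w : W), f.1 (c • w) = c ^ m * f.1 w

variable (W) in
/-- The Zariski topology on the projective space `ℙ(W)`: the sets `{f ≠ 0}` for `f` homogeneous
form a basis of open sets. -/
abbrev projZariski : TopologicalSpace (ℙ k W) :=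
  TopologicalSpace.generateFrom
    {U | ∃ (m : ℕ) (f : regFun k W), IsHomog k m f ∧ U = {p | f.1 p.rep ≠ 0}}

/-- The affine cone over a subset of projective space. -/
def affineCone (Z : Set (ℙ k W)) : Set W :=
  {w | ∀ h : w ≠ 0, Projectivization.mk k w h ∈ Z}

/-- The homogeneous coordinate ring of `Z ⊆ ℙ(W)`. -/
abbrev HomogCoordRing (Z : Set (ℙ k W)) : Type _ := CoordRing k (affineCone k Z)

/-- The total ring of fractions of the homogeneous coordinate ring of `Z ⊆ ℙ(W)`. -/
def HomogFrac (Z : Set (ℙ k W)) : Type _ := FractionRing (HomogCoordRing k Z)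

instance (Z : Set (ℙ k W)) : CommRing (HomogFrac k Z) :=
  inferInstanceAs (CommRing (FractionRing (HomogCoordRing k Z)))

instance (Z : Set (ℙ k W)) : Algebra (HomogCoordRing k Z) (HomogFrac k Z) :=
  inferInstanceAs (Algebra (HomogCoordRing k Z) (FractionRing (HomogCoordRing k Z)))

instance (Z : Set (ℙ k W)) : Algebra k (HomogFrac k Z) :=
  inferInstanceAs (Algebra k (FractionRing (HomogCoordRing k Z)))

instance (Z : Set (ℙ k W)) : IsScalarTower k (HomogCoordRing k Z) (HomogFrac k Z) :=
  inferInstanceAs (IsScalarTower k (HomogCoordRing k Z) (FractionRing (HomogCoordRing k Z)))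

instance (Z : Set (ℙ k W)) :
    IsLocalization (nonZeroDivisors (HomogCoordRing k Z)) (HomogFrac k Z) :=
  inferInstanceAs (IsLocalization (nonZeroDivisors (HomogCoordRing k Z))
    (FractionRing (HomogCoordRing k Z)))

/-- The homomorphism sending a polynomial function on `W` to its class in the total ring of
fractions of the homogeneous coordinate ring of `Z`. -/
def toFrac (Z : Set (ℙ k W)) : regFun k W →ₐ[k] HomogFrac k Z :=
  (IsScalarTower.toAlgHom k (HomogCoordRing k Z) (HomogFrac k Z)).comp
    (restr k (affineCone k Z))

/-- The algebra `k(Z)` of rational functions on `Z ⊆ ℙ(W)`: the quotients `a/b` of homogeneous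
elements of the same degree of the homogeneous coordinate ring, `b` not a zero divisor (that is,
`b ≠ 0` when `Z` is irreducible). For irreducible closed `Z` it is the function field of `Z`. -/
def projFunctionField (Z : Set (ℙ k W)) : Subalgebra k (HomogFrac k Z) where
  carrier := {r | ∃ (m : ℕ) (a b : regFun k W), IsHomog k m a ∧ IsHomog k m b ∧
    restr k (affineCone k Z) b ∈ nonZeroDivisors (HomogCoordRing k Z) ∧
    r * toFrac k Z b = toFrac k Z a}
  mul_mem' := by
    rintro r s ⟨m, a, b, ha, hb, hb0, h⟩ ⟨n, a', b', ha', hb', hb0', h'⟩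
    refine ⟨m + n, a * a', b * b', fun c w => ?_, fun c w => ?_, ?_, ?_⟩
    · change a.1 (c • w) * a'.1 (c • w) = c ^ (m + n) * (a.1 w * a'.1 w)
      rw [ha, ha']; ring
    · change b.1 (c • w) * b'.1 (c • w) = c ^ (m + n) * (b.1 w * b'.1 w)
      rw [hb, hb']; ring
    · rw [map_mul]
      exact mul_mem hb0 hb0'
    · rw [map_mul, map_mul, ← h, ← h']; ring
  add_mem' := by
    rintro r s ⟨m, a, b, ha, hb, hb0, h⟩ ⟨n, a', b', ha', hb', hb0', h'⟩
    refine ⟨m + n, a * b' + a' * b, b * b', fun c w => ?_, fun c w => ?_, ?_, ?_⟩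
    · change a.1 (c • w) * b'.1 (c • w) + a'.1 (c • w) * b.1 (c • w) =
        c ^ (m + n) * (a.1 w * b'.1 w + a'.1 w * b.1 w)
      rw [ha, ha', hb, hb']; ring
    · change b.1 (c • w) * b'.1 (c • w) = c ^ (m + n) * (b.1 w * b'.1 w)
      rw [hb, hb']; ring
    · rw [map_mul]
      exact mul_mem hb0 hb0'
    · rw [map_add, map_mul, map_mul, map_mul, ← h, ← h']; ring
  algebraMap_mem' := fun t => by
    refine ⟨0, algebraMap k _ t, 1, fun c w => ?_, fun c w => ?_, ?_, ?_⟩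
    · change t = c ^ 0 * t
      simp
    · change (1 : k) = c ^ 0 * 1
      simp
    · rw [map_one]
      exact one_mem _
    · rw [map_one, mul_one, AlgHom.commutes]

variable {k} in
/-- The rational function `r ∈ k(Z)` is defined at the point `p` of `Z` and takes the value `c`
there. -/
def ProjHasValueAt {Z : Set (ℙ k W)} (r : projFunctionField k Z) (p : ℙ k W) (c : k) : Prop :=
  ∃ (m : ℕ) (a b : regFun k W), IsHomog k m a ∧ IsHomog k m b ∧ b.1 p.rep ≠ 0 ∧
    r.1 * toFrac k Z b = toFrac k Z a ∧ c = a.1 p.rep / b.1 p.rep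

end Projective

/-! ### The Grassmannian -/

section Grassmannian

variable (k V : Type*) [Field k] [AddCommGroup V] [Module k V]

/-- The Grassmannian `Gr_d(V)` of `d`-dimensional linear subspaces of `V`. -/
def Gr (d : ℕ) : Type _ := {L : Submodule k V // Module.finrank k L = d}

variable {k V}

theorem iotaMulti_ne_zero {d : ℕ} {v : Fin d → V} (hv : LinearIndependent k v) :
    exteriorPower.ιMulti k d v ≠ 0 := by
  have h := (exteriorPower.ιMulti_family_linearIndependent_field (n := d) hv).ne_zero
    (Set.powersetCard.ofFinEmbEquiv (OrderIso.refl (Fin d)).toOrderEmbedding)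
  rw [exteriorPower.ιMulti_family, Equiv.symm_apply_apply] at h
  exact h

variable [FiniteDimensional k V]

/-- The Plücker embedding `Gr_d(V) → ℙ(⋀^d V)`, `L ↦ [v₁ ∧ ⋯ ∧ v_d]` for a basis
`v₁, …, v_d` of `L`. -/
def plucker (d : ℕ) (L : Gr k V d) : ℙ k (⋀[k]^d V) :=
  Projectivization.mk k
    (exteriorPower.ιMulti k d fun i => (Module.finBasisOfFinrankEq k L.1 L.2 i : V))
    (iotaMulti_ne_zero ((Module.finBasisOfFinrankEq k L.1 L.2).linearIndependent.map'
      L.1.subtype L.1.ker_subtype))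

/-- The Zariski topology on the Grassmannian, via the Plücker embedding. -/
instance (d : ℕ) : TopologicalSpace (Gr k V d) :=
  TopologicalSpace.induced (plucker d) (projZariski k (⋀[k]^d V))

/-- The function field of an irreducible closed subvariety `Y` of the Grassmannian, viewed as a
projective variety in the Plücker embedding. -/
abbrev grFunctionField {d : ℕ} (Y : Set (Gr k V d)) :
    Subalgebra k (HomogFrac k (plucker d '' Y)) :=
  projFunctionField k (plucker d '' Y)

/-- The dimension of an irreducible closed subvariety of the Grassmannian: the transcendence
degree over `k` of its function field. -/
def grDim {d : ℕ} (Y : Set (Gr k V d)) : Cardinal :=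
  Algebra.trdeg k (grFunctionField Y)

end Grassmannian

/-! ### Linear semigroups of endomorphisms -/

section Semigroups

variable (k V : Type*) [Field k] [AddCommGroup V] [Module k V]

/-- A linear semigroup `E ⊆ End(V)`: a linear subspace of the space of polynomial endomorphisms
of `V` which is closed under composition and contains the identity. -/
structure LinearSemigroup extends Submodule k (V → V) where
  isPolyMap : ∀ φ ∈ toSubmodule, IsPolyMap k φ
  id_mem : id ∈ toSubmodule
  comp_mem : ∀ φ ∈ toSubmodule, ∀ ψ ∈ toSubmodule, φ ∘ ψ ∈ toSubmodule

variable {k V}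

namespace LinearSemigroup

variable (E : LinearSemigroup k V)

/-- The orbit `E(x) = {φ x | φ ∈ E}`, a linear subspace of `V`. -/
def orbit (x : V) : Submodule k V := E.toSubmodule.map (LinearMap.proj x)

/-- `S` is stable under `E`. -/
def Stable (S : Set V) : Prop := ∀ φ ∈ E.toSubmodule, ∀ x ∈ S, φ x ∈ S

/-- `d(X)`, the maximum of the dimensions of the orbits `E(x)`, `x ∈ X`. -/
def d (X : Set V) : ℕ := sSup {n | ∃ x ∈ X, Module.finrank k (E.orbit x) = n}

/-- `X'`, the set of the points of `X` whose orbit has maximal dimension. -/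
def reg (X : Set V) : Set V := {x | x ∈ X ∧ Module.finrank k (E.orbit x) = E.d X}

/-- The map `π : X' → Gr_{d(X)}(V)`, `x ↦ E(x)`. -/
def quotMap (X : Set V) (x : E.reg X) : Gr k V (E.d X) := ⟨E.orbit x, x.2.2⟩

section Infinite

variable [Infinite k] {E}

/-- An `E`-stable subset is invariant under the vector fields attached to `E`. -/
theorem vectorField_invariant {S : Set V} (hS : E.Stable S) {φ : V → V} (hφ : φ ∈ E.toSubmodule)
    {f g : regFun k V} (hfg : restr k S f = restr k S g) :
    restr k S (vectorField φ (E.isPolyMap φ hφ) f) =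
      restr k S (vectorField φ (E.isPolyMap φ hφ) g) := by
  refine coordRing_ext fun x => ?_
  change dirDeriv k f.1 x (φ x) = dirDeriv k g.1 x (φ x)
  obtain ⟨p, hp⟩ := exists_poly f.2 (x : V) (φ x)
  rw [dirDeriv_eq hp, dirDeriv_eq fun t => (hp t).trans ?_]
  have hx : (x : V) + t • φ x ∈ S :=
    hS (id + t • φ) (E.toSubmodule.add_mem E.id_mem (E.toSubmodule.smul_mem t hφ)) x x.2
  exact congrArg (evalAt ⟨_, hx⟩) hfg

/-- The restriction to an `E`-stable subset `S` of the vector field `ξ_φ`, `φ ∈ E`, as a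
derivation of the coordinate ring of `S`. -/
def vectorFieldOn {S : Set V} (hS : E.Stable S) (φ : V → V) (hφ : φ ∈ E.toSubmodule) :
    Derivation k (CoordRing k S) (CoordRing k S) :=
  let D := vectorField φ (E.isPolyMap φ hφ)
  let lift := Function.surjInv (restr_surjective k S)
  have hl : ∀ f, restr k S (lift f) = f := Function.surjInv_eq (restr_surjective k S)
  Derivation.mk'
    { toFun := fun f => restr k S (D (lift f))
      map_add' := fun f g => by
        rw [vectorField_invariant hS hφ (g := lift f + lift g)
          (by rw [map_add, hl, hl, hl]), Derivation.map_add, map_add]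
      map_smul' := fun r f => by
        rw [vectorField_invariant hS hφ (g := r • lift f)
          (by rw [AlgHom.map_smul_of_tower, hl, hl]), Derivation.map_smul,
            AlgHom.map_smul_of_tower]
        rfl }
    (fun f g => by
      change restr k S (D (lift (f * g))) = f * restr k S (D (lift g)) + g * restr k S (D (lift f))
      rw [vectorField_invariant hS hφ (g := lift f * lift g)
          (by rw [map_mul, hl, hl, hl]), Derivation.leibniz, map_add, smul_eq_mul,
          smul_eq_mul, map_mul, map_mul, hl, hl])

theorem vectorFieldOn_restr {S : Set V} (hS : E.Stable S) (φ : V → V) (hφ : φ ∈ E.toSubmodule)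
    (f : regFun k V) : vectorFieldOn hS φ hφ (restr k S f) =
      restr k S (vectorField φ (E.isPolyMap φ hφ) f) :=
  vectorField_invariant hS hφ (Function.surjInv_eq (restr_surjective k S) _)

variable (E)

/-- The field of first integrals: the rational functions `f` on the `E`-stable irreducible closed
subvariety `X` with `ξ f = 0` for all the vector fields `ξ = ξ_φ`, `φ ∈ E`. -/
def firstIntegrals (X : IrredSubvariety k V) (hX : E.Stable X.carrier) :
    IntermediateField k X.functionField where
  carrier := {f | ∀ (φ : V → V) (hφ : φ ∈ E.toSubmodule), fracDeriv X.functionField (vectorFieldOn hX φ hφ) f = 0}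
  mul_mem' := fun {f g} hf hg φ hφ => by rw [Derivation.leibniz, hf φ hφ, hg φ hφ]; simp
  add_mem' := fun {f g} hf hg φ hφ => by rw [Derivation.map_add, hf φ hφ, hg φ hφ, add_zero]
  algebraMap_mem' := fun r φ hφ => Derivation.map_algebraMap _ r
  inv_mem' := fun f hf φ hφ => by rw [Derivation.leibniz_inv, hf φ hφ, smul_zero]

end Infinite

end LinearSemigroup

end Semigroups

end LinSemi

end

open LinSemi

/-! Write d = d(X). Composition in E gives E(y) ⊆ E(x) for y ∈ E(x), so two points of X' have the
same orbit exactly when one lies in the orbit of the other; this is the fibre statement.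

Choose x₀ ∈ X' and φ₁, …, φ_d ∈ E with the vectors φᵢ(x₀) independent. Near x₀ the map π is x ↦ [φ₁x
∧ … ∧ φ_d x], so rational functions on the closure of its image pull back to quotients of
homogeneous forms of equal degree in this multivector (`ratPullback`). These are first integrals:
for χ ∈ E the line x + tχ(x) stays in E(x), along it the multivector is only rescaled, and a
quotient of degree 0 does not see the factor (`range_ratPullback_le`).

Conversely, let M be the field of pullbacks and F ⊇ M the field of first integrals. Choose linear
forms s₁, …, s_d with det sᵢ(φⱼ x₀) ≠ 0. Generically x ∈ E(x) = ⟨φ₁x, …, φ_d x⟩, so Cramer's rule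
writes every linear form on X as a combination of the sᵢ with coefficients in M; hence k(X) = M(s₁,
…, s_d). The matrix of the functions ξ_{φⱼ} sᵢ = sᵢ(φⱼ) is invertible over k(X), so combinations of
the ξ_{φⱼ} are derivations that kill F and act on the sᵢ as partial derivatives. In characteristic 0
the sᵢ are therefore algebraically independent over F (`algebraicIndependent_of_derivation`).
Comparing coefficients in f·Q(s) = P(s) for f ∈ F gives F = M
(`toSubalgebra_le_of_algebraicIndependent`), and s is a transcendence basis of k(X) over F, which
gives the dimension formula.

If F = k, the Cramer coefficients are constants, so X spans a space of dimension at most d. Since X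
contains the d-dimensional space E(x₀), it equals E(x₀). -/

noncomputable section

namespace LinSemi

/-! ### Orbits and the fibres of π -/

section Orbits

variable {k V : Type*} [Field k] [AddCommGroup V] [Module k V]

namespace LinearSemigroup

variable {E : LinearSemigroup k V} {S : Set V}

theorem mem_orbit {x y : V} : y ∈ E.orbit x ↔ ∃ φ ∈ E.toSubmodule, φ x = y := Iff.rfl

theorem apply_mem_orbit {φ : V → V} (hφ : φ ∈ E.toSubmodule) (x : V) : φ x ∈ E.orbit x :=
  mem_orbit.2 ⟨φ, hφ, rfl⟩

theorem self_mem_orbit (x : V) : x ∈ E.orbit x := apply_mem_orbit E.id_mem x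

theorem orbit_le_of_mem {x y : V} (h : y ∈ E.orbit x) : E.orbit y ≤ E.orbit x := by
  obtain ⟨φ, hφ, rfl⟩ := mem_orbit.1 h
  intro z hz
  obtain ⟨ψ, hψ, rfl⟩ := mem_orbit.1 hz
  exact mem_orbit.2 ⟨ψ ∘ φ, E.comp_mem ψ hψ φ hφ, rfl⟩

theorem orbit_subset (hS : E.Stable S) {x : V} (hx : x ∈ S) : (E.orbit x : Set V) ⊆ S := by
  intro y hy
  obtain ⟨φ, hφ, rfl⟩ := mem_orbit.1 hy
  exact hS φ hφ x hx

variable [FiniteDimensional k V]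

theorem bddAbove_finrank_orbit (E : LinearSemigroup k V) (S : Set V) :
    BddAbove {n | ∃ x ∈ S, Module.finrank k (E.orbit x) = n} :=
  ⟨Module.finrank k V, by rintro _ ⟨x, -, rfl⟩; exact Submodule.finrank_le _⟩

theorem finrank_orbit_le_d {x : V} (hx : x ∈ S) : Module.finrank k (E.orbit x) ≤ E.d S :=
  le_csSup (bddAbove_finrank_orbit E S) ⟨x, hx, rfl⟩

theorem reg_nonempty (E : LinearSemigroup k V) (hS : S.Nonempty) : (E.reg S).Nonempty := by
  obtain ⟨y, hy⟩ := hS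
  obtain ⟨x, hx, h⟩ := Nat.sSup_mem (s := {n | ∃ x ∈ S, Module.finrank k (E.orbit x) = n})
    ⟨_, y, hy, rfl⟩ (bddAbove_finrank_orbit E S)
  exact ⟨x, hx, h⟩

/-- Membership gives an inclusion of orbits, and both have the same dimension d(S), so the inclusion
is an equality. -/
theorem orbit_eq_iff_mem_orbit {x y : V} (hx : x ∈ E.reg S) (hy : y ∈ E.reg S) :
    E.orbit y = E.orbit x ↔ y ∈ E.orbit x :=
  ⟨fun h => h ▸ self_mem_orbit y, fun h =>
    Submodule.eq_of_le_of_finrank_eq (orbit_le_of_mem h) (hy.2.trans hx.2.symm)⟩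

theorem image_quotMap_fibre (x : E.reg S) :
    (Subtype.val '' (E.quotMap S ⁻¹' {E.quotMap S x}) : Set V) =
      (E.orbit x : Set V) ∩ E.reg S := by
  ext y
  constructor
  · rintro ⟨z, hz, rfl⟩
    exact ⟨(orbit_eq_iff_mem_orbit x.2 z.2).1 (congrArg Subtype.val hz), z.2⟩
  · rintro ⟨h1, h2⟩
    exact ⟨⟨y, h2⟩, Subtype.ext ((orbit_eq_iff_mem_orbit x.2 h2).2 h1), rfl⟩

/-- An orbit of maximal dimension has a basis consisting of values of elements of `E`. -/
theorem exists_linearIndependent_apply {x : V} (hx : x ∈ E.reg S) :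
    ∃ φ : Fin (E.d S) → E.toSubmodule, LinearIndependent k fun i => (φ i).1 x := by
  let b := Module.finBasisOfFinrankEq k (E.orbit x) hx.2
  choose φ hφ h using fun i => mem_orbit.1 (b i).2
  refine ⟨fun i => ⟨φ i, hφ i⟩, ?_⟩
  simp only [h]
  exact b.linearIndependent.map' (E.orbit x).subtype (E.orbit x).ker_subtype

/-- Independent values of d(S) elements of E bound the dimension of the orbit from below, and d(S)
is its maximum. -/
theorem mem_reg_of_linearIndependent {x : V} (hx : x ∈ S)
    {φ : Fin (E.d S) → E.toSubmodule} (h : LinearIndependent k fun i => (φ i).1 x) :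
    x ∈ E.reg S := by
  refine ⟨hx, (finrank_orbit_le_d hx).antisymm ?_⟩
  have h2 : LinearIndependent k
      (fun i => (⟨(φ i).1 x, apply_mem_orbit (φ i).2 x⟩ : E.orbit x)) :=
    LinearIndependent.of_comp (E.orbit x).subtype h
  simpa using h2.fintype_card_le_finrank

theorem span_eq_orbit {x : V} (hx : x ∈ S)
    {φ : Fin (E.d S) → E.toSubmodule} (h : LinearIndependent k fun i => (φ i).1 x) :
    Submodule.span k (Set.range fun i => (φ i).1 x) = E.orbit x := by
  refine Submodule.eq_of_le_of_finrank_eq (Submodule.span_le.2 ?_) ?_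
  · rintro _ ⟨i, rfl⟩
    exact apply_mem_orbit (φ i).2 x
  · rw [finrank_span_eq_card h, (mem_reg_of_linearIndependent hx h).2, Fintype.card_fin]

end LinearSemigroup

end Orbits

/-! ### Decomposable multivectors and Cramer's rule -/

section Multivectors

variable {k V : Type*} [Field k] [AddCommGroup V] [Module k V]

theorem iotaMulti_ne_zero_iff {d : ℕ} {v : Fin d → V} :
    exteriorPower.ιMulti k d v ≠ 0 ↔ LinearIndependent k v :=
  ⟨fun h => by_contra fun h2 => h ((exteriorPower.ιMulti k d).map_linearDependent v h2),
    iotaMulti_ne_zero⟩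

/-- The multivectors of families in the span of `v` are multiples of that of `v`. -/
theorem exists_iotaMulti_eq_smul {d : ℕ} {v w : Fin d → V} (hv : LinearIndependent k v)
    (hw : ∀ i, w i ∈ Submodule.span k (Set.range v)) :
    ∃ c : k, exteriorPower.ιMulti k d w = c • exteriorPower.ιMulti k d v := by
  classical
  let b := Module.Basis.span hv
  let f := (exteriorPower.ιMulti k d).compLinearMap (Submodule.span k (Set.range v)).subtype
  have hf : f = ((LinearMap.toSpanSingleton k _ (f b)).compAlternatingMap b.det) := by
    -- Alternating maps are determined on injective families of basis vectors; here these are the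
    -- permutations of the basis, where both sides are the same sign times `f b`.
    refine Module.Basis.ext_alternating b fun i hi => ?_
    have hi2 : Function.Bijective i := Finite.injective_iff_bijective.1 hi
    obtain ⟨σ, rfl⟩ : ∃ σ : Equiv.Perm (Fin d), i = σ := ⟨Equiv.ofBijective i hi2, rfl⟩
    change f (b ∘ σ) = b.det (b ∘ σ) • f b
    rw [AlternatingMap.map_perm, AlternatingMap.map_perm, b.det_self, smul_assoc, one_smul]
  have hb : f b = exteriorPower.ιMulti k d v := by
    change exteriorPower.ιMulti k d (fun i => (b i : V)) = _
    congr 1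
    ext i
    exact congrArg _ (Module.Basis.span_apply hv i) |>.trans rfl
  refine ⟨b.det fun i => ⟨w i, hw i⟩, ?_⟩
  rw [← hb]
  exact DFunLike.congr_fun hf fun i => ⟨w i, hw i⟩

/-- The linear form `v₁ ∧ ⋯ ∧ v_d ↦ det (lᵢ (vⱼ))` on the exterior power. -/
def detForm {d : ℕ} (l : Fin d → Module.Dual k V) : Module.Dual k (⋀[k]^d V) :=
  exteriorPower.alternatingMapLinearEquiv
    ((Matrix.detRowAlternating (n := Fin d) (R := k)).compLinearMap (LinearMap.pi l))

theorem detForm_iotaMulti {d : ℕ} (l : Fin d → Module.Dual k V) (v : Fin d → V) :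
    detForm l (exteriorPower.ιMulti k d v) = (Matrix.of fun i j => l i (v j)).det := by
  rw [detForm, exteriorPower.alternatingMapLinearEquiv_apply_ιMulti, ← Matrix.det_transpose]
  rfl

/-- Cramer's rule for linear forms restricted to the span of `v`. -/
theorem detForm_mul_eq_sum {d : ℕ} (s : Fin d → Module.Dual k V) (l : Module.Dual k V)
    {v : Fin d → V} {y : V} (hy : y ∈ Submodule.span k (Set.range v)) :
    detForm s (exteriorPower.ιMulti k d v) * l y =
      ∑ i, detForm (Function.update s i l) (exteriorPower.ιMulti k d v) * s i y := by
  classical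
  have h : ∀ i, detForm (Function.update s i l) (exteriorPower.ιMulti k d v) =
      (Matrix.of fun i j => s i (v j)).transpose.cramer (fun j => l (v j)) i := fun i => by
    rw [detForm_iotaMulti, Matrix.cramer_transpose_apply]
    congr 1
    ext a j
    by_cases ha : a = i
    · subst ha; simp
    · simp [ha]
  induction hy using Submodule.span_induction with
  | mem y hy =>
    obtain ⟨j, rfl⟩ := hy
    have := congrFun (Matrix.mulVec_cramer (Matrix.of fun i j => s i (v j)).transpose
      (fun j => l (v j))) j
    simp only [h]
    rw [detForm_iotaMulti, ← Matrix.det_transpose]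
    refine this.symm.trans ?_
    simp [Matrix.mulVec, dotProduct, mul_comm]
  | zero => simp
  | add a b _ _ ha hb => simp only [map_add, mul_add, ha, hb, Finset.sum_add_distrib]
  | smul c a _ ha =>
    simp only [map_smul, smul_eq_mul, mul_left_comm _ c, ha, Finset.mul_sum]

theorem exists_detForm_ne_zero {d : ℕ} {v : Fin d → V} (hv : LinearIndependent k v) :
    ∃ s : Fin d → Module.Dual k V, detForm s (exteriorPower.ιMulti k d v) ≠ 0 := by
  classical
  obtain ⟨g, hg⟩ := (Finsupp.linearCombination k v).exists_leftInverse_of_injective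
    (LinearMap.ker_eq_bot.2 hv)
  -- The coordinate forms with respect to `v`, extended to V through the left inverse `g`; their
  -- matrix on `v` is the identity.
  refine ⟨fun i => (Finsupp.lapply i).comp g, ?_⟩
  have : (Matrix.of fun i j => ((Finsupp.lapply i).comp g : Module.Dual k V) (v j)) = 1 := by
    ext i j
    have := LinearMap.congr_fun hg (Finsupp.single j 1)
    simp only [LinearMap.comp_apply, Finsupp.linearCombination_single, one_smul,
      LinearMap.id_apply] at this
    simp [this, Matrix.one_apply, Finsupp.single_apply, eq_comm]
  rw [detForm_iotaMulti, this, Matrix.det_one]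
  exact one_ne_zero

end Multivectors

/-! ### Regularity of compositions -/

section RegularFunctions

variable {k V W : Type*} [Field k] [AddCommGroup V] [Module k V] [AddCommGroup W] [Module k W]

theorem dual_mem_regFun (l : Module.Dual k V) : (l : V → k) ∈ regFun k V :=
  Algebra.subset_adjoin ⟨l, rfl⟩

/-- Composing with a map all of whose coordinates are regular preserves regularity. -/
theorem regFun_comp {g : V → W} (hg : ∀ l : Module.Dual k W, (fun v => l (g v)) ∈ regFun k V)
    {f : W → k} (hf : f ∈ regFun k W) : f ∘ g ∈ regFun k V := by
  induction hf using Algebra.adjoin_induction with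
  | mem f hf =>
    obtain ⟨l, rfl⟩ := hf
    exact hg l
  | algebraMap r => exact (regFun k V).algebraMap_mem r
  | add f h _ _ hf hh => exact (regFun k V).add_mem hf hh
  | mul f h _ _ hf hh => exact (regFun k V).mul_mem hf hh

/-- Expanding every argument in a basis gives a polynomial in the coordinates of the φᵢ x. It makes
the Plücker coordinates of π regular. -/
theorem multilinearMap_comp_mem_regFun [FiniteDimensional k V] {d : ℕ}
    (m : MultilinearMap k (fun _ : Fin d => V) k) {φ : Fin d → V → V}
    (hφ : ∀ i, IsPolyMap k (φ i)) : (fun x => m fun i => φ i x) ∈ regFun k V := by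
  classical
  let b := Module.finBasis k V
  have h : (fun x => m fun i => φ i x) =
      ∑ r : Fin d → Fin (Module.finrank k V), m (fun i => b (r i)) •
        ∏ i, fun x => b.coord (r i) (φ i x) := by
    ext x
    have : (fun i => φ i x) = fun i => ∑ j, b.coord j (φ i x) • b j := by
      ext i; simp
    rw [this, m.map_sum]
    simp [m.map_smul_univ, mul_comm]
  rw [h]
  exact Subalgebra.sum_mem _ fun r _ => Subalgebra.smul_mem _
    (Subalgebra.prod_mem _ fun i _ => hφ i _) _

end RegularFunctions

/-! ### Density on irreducible varieties and homogeneous decomposition -/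

section Density

variable {k V : Type*} [Field k] [AddCommGroup V] [Module k V]

/-- Two regular functions on an irreducible variety are equal if they agree where some nonzero
regular function does not vanish. -/
theorem IrredSubvariety.coordRing_ext_of_ne_zero {X : IrredSubvariety k V} {h f g : X.coordRing}
    (hh : h ≠ 0) (H : ∀ x, evalAt x h ≠ 0 → evalAt x f = evalAt x g) : f = g := by
  refine mul_left_cancel₀ hh (coordRing_ext fun x => ?_)
  rw [map_mul, map_mul]
  by_cases hx : evalAt x h = 0
  · rw [hx, zero_mul, zero_mul]
  · rw [H x hx]

theorem isOpen_setOf_ne_zero (f : regFun k V) : IsOpen[zariski k V] {v | f.1 v ≠ 0} :=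
  TopologicalSpace.isOpen_generateFrom_of_mem ⟨f.1, f.2, rfl⟩

theorem IsHomog.rep_eq_zero_iff {m : ℕ} {f : regFun k V} (hf : IsHomog k m f) {v : V}
    (hv : v ≠ 0) : f.1 (Projectivization.mk k v hv).rep = 0 ↔ f.1 v = 0 := by
  obtain ⟨a, ha⟩ := Projectivization.exists_smul_eq_mk_rep k v hv
  rw [← ha, Units.smul_def, hf]
  simp

theorem isHomog_dual (l : Module.Dual k V) : IsHomog k 1 ⟨l, dual_mem_regFun l⟩ :=
  fun c w => by simp

theorem IsHomog.mul {m n : ℕ} {f g : regFun k V} (hf : IsHomog k m f) (hg : IsHomog k n g) :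
    IsHomog k (m + n) (f * g) := fun c w => by
  change f.1 (c • w) * g.1 (c • w) = c ^ (m + n) * (f.1 w * g.1 w)
  rw [hf, hg]
  ring

theorem IsHomog.add {m : ℕ} {f g : regFun k V} (hf : IsHomog k m f) (hg : IsHomog k m g) :
    IsHomog k m (f + g) := fun c w => by
  change f.1 (c • w) + g.1 (c • w) = c ^ m * (f.1 w + g.1 w)
  rw [hf, hg]
  ring

theorem isHomog_algebraMap (t : k) : IsHomog k 0 (algebraMap k (regFun k V) t) := fun c w => by
  change t = c ^ 0 * t
  simp

/-- Every regular function is a sum of homogeneous ones. -/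
theorem exists_eq_sum_isHomog (f : regFun k V) :
    ∃ (n : ℕ) (g : ℕ → regFun k V), (∀ i, IsHomog k i (g i)) ∧ f = ∑ i ∈ Finset.range n, g i := by
  have hz : ∀ i, IsHomog k i (0 : regFun k V) := fun i c w => by
    change (0 : k) = c ^ i * 0
    simp
  let S : Submodule k (regFun k V) := Submodule.span k {g | ∃ i, IsHomog k i g}
  -- The vanishing of `g i` for i ≥ n is carried along so that two decompositions of different
  -- lengths can be padded and added.
  have hS : ∀ f ∈ S, ∃ (n : ℕ) (g : ℕ → regFun k V), (∀ i, IsHomog k i (g i)) ∧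
      (∀ i, n ≤ i → g i = 0) ∧ f = ∑ i ∈ Finset.range n, g i := by
    intro f hf
    induction hf using Submodule.span_induction with
    | mem f hf =>
      obtain ⟨i, hi⟩ := hf
      refine ⟨i + 1, Pi.single i f, fun j => ?_, fun j hj => ?_, ?_⟩
      · by_cases h : j = i
        · subst h; simpa using hi
        · simpa [h] using hz j
      · exact Pi.single_eq_of_ne (M := fun _ => regFun k V) (show j ≠ i by omega) f
      · simp
    | zero => exact ⟨0, 0, hz, fun _ _ => rfl, by simp⟩
    | add f g _ _ hf hg =>
      obtain ⟨n, a, ha, ha0, rfl⟩ := hf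
      obtain ⟨m, b, hb, hb0, rfl⟩ := hg
      refine ⟨max n m, a + b, fun i => (ha i).add (hb i), fun i hi => ?_, ?_⟩
      · simp [ha0 i (le_of_max_le_left hi), hb0 i (le_of_max_le_right hi)]
      · simp only [Pi.add_apply, Finset.sum_add_distrib]
        congr 1
        · exact Finset.sum_subset (Finset.range_mono (le_max_left _ _)) fun i _ hi =>
            ha0 i (by simpa using hi)
        · exact Finset.sum_subset (Finset.range_mono (le_max_right _ _)) fun i _ hi =>
            hb0 i (by simpa using hi)
    | smul c f _ hf =>
      obtain ⟨n, a, ha, ha0, rfl⟩ := hf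
      refine ⟨n, fun i => c • a i, fun i => ?_, fun i hi => by simp [ha0 i hi],
        Finset.smul_sum⟩
      have := (isHomog_algebraMap (V := V) c).mul (ha i)
      rwa [zero_add, ← Algebra.smul_def] at this
  suffices h : ∀ (f : V → k) (hf : f ∈ regFun k V), (⟨f, hf⟩ : regFun k V) ∈ S by
    obtain ⟨n, g, hg, -, h⟩ := hS f (h f.1 f.2)
    exact ⟨n, g, hg, h⟩
  intro f hf
  induction hf using Algebra.adjoin_induction with
  | mem f hf =>
    obtain ⟨l, rfl⟩ := hf
    exact Submodule.subset_span ⟨1, isHomog_dual l⟩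
  | algebraMap r => exact Submodule.subset_span ⟨0, isHomog_algebraMap r⟩
  | add f g hf hg h1 h2 => exact S.add_mem h1 h2
  | mul f g hf hg h1 h2 =>
    have : S * S ≤ S := by
      rw [Submodule.span_mul_span]
      refine Submodule.span_le.2 ?_
      rintro _ ⟨a, ⟨i, ha⟩, b, ⟨j, hb⟩, rfl⟩
      exact Submodule.subset_span ⟨i + j, ha.mul hb⟩
    exact this (Submodule.mul_mem_mul h1 h2)

/-- If a sum of homogeneous functions vanishes at all nonzero multiples of a vector, then so do
its homogeneous summands. -/
theorem eq_zero_of_sum_isHomog_eq_zero [Infinite k] {n : ℕ} {g : ℕ → regFun k V}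
    (hg : ∀ i, IsHomog k i (g i)) {w : V}
    (h : ∀ t : k, t ≠ 0 → (∑ i ∈ Finset.range n, g i).1 (t • w) = 0) {i : ℕ} (hi : i < n) :
    (g i).1 w = 0 := by
  let p : k[X] := ∑ i ∈ Finset.range n, Polynomial.monomial i ((g i).1 w)
  -- At t ≠ 0 the value of `p` is that of the sum at `t • w`. The factor X covers t = 0, where
  -- nothing is assumed.
  have hp : p * Polynomial.X = 0 := Polynomial.funext fun t => by
    by_cases ht : t = 0
    · simp [ht]
    · have h2 := h t ht
      have h3 : (∑ i ∈ Finset.range n, g i).1 (t • w) = p.eval t := by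
        simp only [p, AddSubmonoidClass.coe_finsetSum, Finset.sum_apply,
          Polynomial.eval_finsetSum, Polynomial.eval_monomial]
        exact Finset.sum_congr rfl fun i _ => by rw [hg i, mul_comm]
      rw [Polynomial.eval_mul, ← h3, h2]
      simp
  have hp0 : p = 0 := (mul_eq_zero.1 hp).resolve_right Polynomial.X_ne_zero
  have := congrArg (Polynomial.coeff · i) hp0
  simpa [p, Polynomial.coeff_monomial, hi] using this

end Density

/-! ### The map π in Plücker coordinates -/

namespace LinearSemigroup

variable {k V : Type*} [Field k] [AddCommGroup V] [Module k V] {E : LinearSemigroup k V} {d : ℕ}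

/-- The map `x ↦ φ₁ x ∧ ⋯ ∧ φ_d x`. -/
def wedge (φ : Fin d → E.toSubmodule) (x : V) : ⋀[k]^d V :=
  exteriorPower.ιMulti k d fun i => (φ i).1 x

variable [FiniteDimensional k V]

/-- Pulling back regular functions along `x ↦ φ₁ x ∧ ⋯ ∧ φ_d x`. -/
def pullback (φ : Fin d → E.toSubmodule) : regFun k (⋀[k]^d V) →ₐ[k] regFun k V where
  toFun f := ⟨f.1 ∘ wedge φ, regFun_comp (fun l => multilinearMap_comp_mem_regFun
    (l.compAlternatingMap (exteriorPower.ιMulti k d)).toMultilinearMap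
      fun i => E.isPolyMap _ (φ i).2) f.2⟩
  map_one' := rfl
  map_mul' _ _ := rfl
  map_zero' := rfl
  map_add' _ _ := rfl
  commutes' _ := rfl

theorem pullback_apply (φ : Fin d → E.toSubmodule) (f : regFun k (⋀[k]^d V)) (x : V) :
    (pullback φ f).1 x = f.1 (wedge φ x) := rfl

/-- The restriction to `S` of the pullback of regular functions along `x ↦ φ₁ x ∧ ⋯ ∧ φ_d x`. -/
def pullbackOn (S : Set V) (φ : Fin d → E.toSubmodule) :
    regFun k (⋀[k]^d V) →ₐ[k] CoordRing k S := (restr k S).comp (pullback φ)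

theorem evalAt_pullbackOn {S : Set V} (φ : Fin d → E.toSubmodule) (f : regFun k (⋀[k]^d V))
    (x : S) : evalAt x (pullbackOn S φ f) = f.1 (wedge φ x) := rfl

variable {S : Set V} {φ ψ : Fin (E.d S) → E.toSubmodule}

/-- The φᵢ x already span E(x), which contains E(y) and so all ψᵢ y. This one proportionality yields
both the independence of the choice of φ and the invariance along the vector fields. -/
theorem exists_wedge_eq_smul {x y : V} (hx : x ∈ S) (hy : y ∈ E.orbit x) (h : wedge φ x ≠ 0) :
    ∃ c : k, wedge ψ y = c • wedge φ x := by
  have h2 := iotaMulti_ne_zero_iff.1 h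
  refine exists_iotaMulti_eq_smul h2 fun i => ?_
  rw [span_eq_orbit hx h2]
  exact orbit_le_of_mem hy (apply_mem_orbit (ψ i).2 y)

theorem mem_reg_of_wedge_ne_zero {x : V} (hx : x ∈ S) (h : wedge φ x ≠ 0) : x ∈ E.reg S :=
  mem_reg_of_linearIndependent hx (iotaMulti_ne_zero_iff.1 h)

theorem exists_wedge_ne_zero {x : V} (hx : x ∈ E.reg S) :
    ∃ φ : Fin (E.d S) → E.toSubmodule, wedge φ x ≠ 0 := by
  obtain ⟨φ, h⟩ := exists_linearIndependent_apply hx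
  exact ⟨φ, iotaMulti_ne_zero h⟩

/-- The Plücker point is defined by an arbitrarily chosen basis of E(x); its multivector is a
multiple of that of the basis φᵢ x. -/
theorem plucker_quotMap (x : E.reg S) (h : wedge φ x ≠ 0) :
    plucker _ (E.quotMap S x) = Projectivization.mk k (wedge φ x) h := by
  have h2 := iotaMulti_ne_zero_iff.1 h
  rw [plucker, Projectivization.mk_eq_mk_iff']
  obtain ⟨c, hc⟩ := exists_iotaMulti_eq_smul (w := fun i =>
    (Module.finBasisOfFinrankEq k (E.quotMap S x).1 (E.quotMap S x).2 i : V)) h2 fun i => by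
      rw [span_eq_orbit x.2.1 h2]
      exact Subtype.prop _
  exact ⟨c, hc.symm⟩

theorem exists_plucker_quotMap_rep (x : E.reg S) (h : wedge φ x ≠ 0) :
    ∃ c : k, c ≠ 0 ∧ (plucker _ (E.quotMap S x)).rep = c • wedge φ x := by
  rw [plucker_quotMap x h]
  obtain ⟨a, ha⟩ := Projectivization.exists_smul_eq_mk_rep k _ h
  exact ⟨a, a.ne_zero, ha.symm⟩

/-- Used to evaluate identities of the homogeneous coordinate ring at multivectors. A zero
multivector is harmless, since 0 lies in every affine cone. -/
theorem wedge_mem_affineCone {x : V} (hx : x ∈ S) (c : k) :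
    c • wedge φ x ∈
      affineCone k (plucker (E.d S) '' closure (Set.range (E.quotMap S))) := by
  intro h
  have h2 : wedge φ x ≠ 0 := right_ne_zero_of_smul h
  refine ⟨E.quotMap S ⟨x, mem_reg_of_wedge_ne_zero hx h2⟩, subset_closure ⟨_, rfl⟩, ?_⟩
  rw [plucker_quotMap _ h2, Projectivization.mk_eq_mk_iff']
  exact ⟨c⁻¹, by rw [smul_smul, inv_mul_cancel₀ (left_ne_zero_of_smul h), one_smul]⟩

section Variety

variable {X : IrredSubvariety k V} {φ ψ : Fin (E.d X.carrier) → E.toSubmodule}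

/-- Regular functions on `X` are equal if they agree where `φ₁ ∧ ⋯ ∧ φ_d` does not vanish. -/
theorem coordRing_ext_of_wedge {x₀ : V} (hx₀ : x₀ ∈ X.carrier) (h₀ : wedge φ x₀ ≠ 0)
    {f g : X.coordRing}
    (H : ∀ x : X.carrier, wedge φ x ≠ 0 → evalAt x f = evalAt x g) : f = g := by
  obtain ⟨l, hl⟩ := Module.Projective.exists_dual_ne_zero k h₀
  refine IrredSubvariety.coordRing_ext_of_ne_zero
    (h := pullbackOn X.carrier φ ⟨l, dual_mem_regFun l⟩) (fun h => hl ?_) fun x hx => H x ?_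
  · simpa [evalAt_pullbackOn] using congrArg (evalAt ⟨x₀, hx₀⟩) h
  · intro h
    apply hx
    change l (wedge φ x) = 0
    rw [h, map_zero]

/-- Cross multiplying quotients of homogeneous functions pulled back along different multivectors. -/
theorem pullbackOn_mul_eq {x₀ : V} (hx₀ : x₀ ∈ X.carrier) (h₀ : wedge φ x₀ ≠ 0)
    {m : ℕ} {a b a' b' : regFun k (⋀[k]^(E.d X.carrier) V)}
    (ha : IsHomog k m a) (hb : IsHomog k m b)
    (h : pullbackOn X.carrier φ (a * b') = pullbackOn X.carrier φ (a' * b)) :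
    pullbackOn X.carrier ψ a * pullbackOn X.carrier φ b' =
      pullbackOn X.carrier φ a' * pullbackOn X.carrier ψ b := by
  refine coordRing_ext_of_wedge hx₀ h₀ fun x hx => ?_
  have h2 : a.1 (wedge φ x) * b'.1 (wedge φ x) = a'.1 (wedge φ x) * b.1 (wedge φ x) :=
    congrArg (evalAt x) h
  simp only [map_mul, evalAt_pullbackOn]
  -- Replacing φ by ψ multiplies the values of `a` and `b` by the same factor `c ^ m`.
  obtain ⟨c, hc⟩ := exists_wedge_eq_smul (ψ := ψ) x.2 (self_mem_orbit x.1) hx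
  rw [hc, ha, hb]
  linear_combination c ^ m * h2

theorem pullbackOn_eq_zero {x₀ : V} (hx₀ : x₀ ∈ X.carrier) (h₀ : wedge φ x₀ ≠ 0)
    {m : ℕ} {a : regFun k (⋀[k]^(E.d X.carrier) V)} (ha : IsHomog k m a)
    (h : pullbackOn X.carrier φ a = 0) : pullbackOn X.carrier ψ a = 0 := by
  refine coordRing_ext_of_wedge hx₀ h₀ fun x hx => ?_
  have h2 : a.1 (wedge φ x) = 0 := congrArg (evalAt x) h
  obtain ⟨c, hc⟩ := exists_wedge_eq_smul (ψ := ψ) x.2 (self_mem_orbit x.1) hx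
  rw [evalAt_pullbackOn, hc, ha, h2, mul_zero, map_zero]

theorem isOpen_setOf_plucker_rep_ne_zero {m d : ℕ} {f : regFun k (⋀[k]^d V)}
    (hf : IsHomog k m f) : IsOpen {L : Gr k V d | f.1 (plucker d L).rep ≠ 0} :=
  ⟨{p | f.1 p.rep ≠ 0}, TopologicalSpace.isOpen_generateFrom_of_mem ⟨m, f, hf, rfl⟩, rfl⟩

/-- A homogeneous function whose pullback to `X` is zero vanishes on the closure of the image of
the quotient map. -/
theorem apply_plucker_rep_eq_zero {x₀ : V} (hx₀ : x₀ ∈ X.carrier) (h₀ : wedge φ x₀ ≠ 0)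
    {m : ℕ} {a : regFun k (⋀[k]^(E.d X.carrier) V)} (ha : IsHomog k m a)
    (h : pullbackOn X.carrier φ a = 0) {L : Gr k V (E.d X.carrier)}
    (hL : L ∈ closure (Set.range (E.quotMap X.carrier))) : a.1 (plucker _ L).rep = 0 := by
  by_contra hne
  obtain ⟨_, h1, ⟨x, rfl⟩⟩ := mem_closure_iff.1 hL _ (isOpen_setOf_plucker_rep_ne_zero ha) hne
  obtain ⟨ψ, hψ⟩ := exists_wedge_ne_zero x.2
  refine h1 ?_
  rw [plucker_quotMap x hψ, ha.rep_eq_zero_iff]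
  exact congrArg (evalAt ⟨x.1, x.2.1⟩) (pullbackOn_eq_zero (ψ := ψ) hx₀ h₀ ha h)

/-- Vanishing at all nonzero multiples passes to the homogeneous summands, and each of these
vanishes on the closure by density. -/
theorem apply_eq_zero_of_mem_affineCone [Infinite k]
    {x₀ : V} (hx₀ : x₀ ∈ X.carrier) (h₀ : wedge φ x₀ ≠ 0)
    {a : regFun k (⋀[k]^(E.d X.carrier) V)}
    (h : ∀ t : k, t ≠ 0 → ∀ x ∈ X.carrier, a.1 (t • wedge φ x) = 0)
    {w : ⋀[k]^(E.d X.carrier) V}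
    (hw : w ∈ affineCone k (plucker _ '' closure (Set.range (E.quotMap X.carrier)))) :
    a.1 w = 0 := by
  obtain ⟨n, g, hg, rfl⟩ := exists_eq_sum_isHomog a
  have hg0 : ∀ i < n, pullbackOn X.carrier φ (g i) = 0 := fun i hi => coordRing_ext fun x =>
    eq_zero_of_sum_isHomog_eq_zero hg (fun t ht => h t ht x x.2) hi
  by_cases hw0 : w = 0
  · have hw1 : ∀ i < n, (g i).1 w = 0 := by
      intro i hi
      have h2 := hg i 0 (wedge φ x₀)
      have h3 : (g i).1 (wedge φ x₀) = 0 := congrArg (evalAt ⟨x₀, hx₀⟩) (hg0 i hi)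
      rw [hw0, ← zero_smul k (wedge φ x₀), h2, h3, mul_zero]
    simp only [AddSubmonoidClass.coe_finsetSum, Finset.sum_apply]
    exact Finset.sum_eq_zero fun i hi => hw1 i (Finset.mem_range.1 hi)
  · obtain ⟨L, hL, hLw⟩ := hw hw0
    simp only [AddSubmonoidClass.coe_finsetSum, Finset.sum_apply]
    refine Finset.sum_eq_zero fun i hi => ?_
    have := apply_plucker_rep_eq_zero hx₀ h₀ (hg i) (hg0 i (Finset.mem_range.1 hi)) hL
    rwa [hLw, (hg i).rep_eq_zero_iff] at this

end Variety

end LinearSemigroup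

/-! ### Continuity of π and irreducibility of the closure of its image -/

namespace LinearSemigroup

variable {k V : Type*} [Field k] [AddCommGroup V] [Module k V] [FiniteDimensional k V]
  {E : LinearSemigroup k V} {S : Set V}

theorem continuous_quotMap (E : LinearSemigroup k V) (S : Set V) :
    @Continuous (E.reg S) (Gr k V (E.d S))
      (TopologicalSpace.induced Subtype.val (zariski k V)) _ (E.quotMap S) := by
  let := zariski k V
  refine continuous_induced_rng.2 (continuous_generateFrom_iff.2 ?_)
  rintro _ ⟨m, f, hf, rfl⟩
  -- The factor `l` removes the points where the multivector vanishes and does not represent π; `f`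
  -- alone need not do so, since in degree 0 it can be nonzero at 0.
  have h : (plucker (E.d S) ∘ E.quotMap S) ⁻¹' {p | f.1 p.rep ≠ 0} =
      Subtype.val ⁻¹' ⋃ (φ : Fin (E.d S) → E.toSubmodule)
        (l : Module.Dual k (⋀[k]^(E.d S) V)),
        {v | (pullback φ (f * ⟨l, dual_mem_regFun l⟩)).1 v ≠ 0} := by
    ext x
    simp only [Set.mem_preimage, Function.comp_apply, Set.mem_ofPred_eq, Set.mem_iUnion]
    constructor
    · intro hx
      obtain ⟨φ, hφ⟩ := exists_wedge_ne_zero x.2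
      obtain ⟨l, hl⟩ := Module.Projective.exists_dual_ne_zero k hφ
      rw [plucker_quotMap x hφ, Ne, hf.rep_eq_zero_iff] at hx
      exact ⟨φ, l, mul_ne_zero hx hl⟩
    · rintro ⟨φ, l, h⟩
      have h1 : f.1 (wedge φ x.1) ≠ 0 := left_ne_zero_of_mul h
      have h2 : l (wedge φ x.1) ≠ 0 := right_ne_zero_of_mul h
      have h3 : wedge φ x.1 ≠ 0 := fun h4 => h2 (by rw [h4, map_zero])
      rwa [plucker_quotMap x h3, Ne, hf.rep_eq_zero_iff]
  rw [h]
  exact (isOpen_iUnion fun φ => isOpen_iUnion fun l =>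
    isOpen_setOf_ne_zero _).preimage continuous_subtype_val

/-- X' is open in X: it is the union over all φ of the loci where the multivector of φ does not
vanish. -/
theorem reg_eq_inter (E : LinearSemigroup k V) (S : Set V) :
    ∃ U : Set V, IsOpen[zariski k V] U ∧ E.reg S = S ∩ U := by
  let := zariski k V
  refine ⟨⋃ (φ : Fin (E.d S) → E.toSubmodule) (l : Module.Dual k (⋀[k]^(E.d S) V)),
    {v | (pullback φ ⟨l, dual_mem_regFun l⟩).1 v ≠ 0},
    isOpen_iUnion fun φ => isOpen_iUnion fun l => isOpen_setOf_ne_zero _, ?_⟩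
  ext x
  simp only [Set.mem_inter_iff, Set.mem_iUnion, Set.mem_ofPred_eq]
  constructor
  · intro hx
    obtain ⟨φ, hφ⟩ := exists_wedge_ne_zero hx
    obtain ⟨l, hl⟩ := Module.Projective.exists_dual_ne_zero k hφ
    exact ⟨hx.1, φ, l, hl⟩
  · rintro ⟨hx, φ, l, h⟩
    refine mem_reg_of_wedge_ne_zero (φ := φ) hx fun h4 => h ?_
    rw [pullback_apply, h4]
    exact map_zero l

/-- Open sets pull back along π to open sets of X', hence of X, and nonempty open subsets of the
irreducible X meet. -/
theorem isIrreducible_closure_range_quotMap (E : LinearSemigroup k V) (X : IrredSubvariety k V) :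
    IsIrreducible (closure (Set.range (E.quotMap X.carrier))) := by
  let := zariski k V
  obtain ⟨x, hx⟩ := reg_nonempty E X.isIrreducible.nonempty
  refine IsIrreducible.closure ⟨⟨_, ⟨x, hx⟩, rfl⟩, ?_⟩
  obtain ⟨U, hU, hUX⟩ := reg_eq_inter E X.carrier
  rintro A B hA hB ⟨_, ⟨y, rfl⟩, hyA⟩ ⟨_, ⟨z, rfl⟩, hzB⟩
  obtain ⟨A', hA', hA2⟩ := (continuous_quotMap E X.carrier).isOpen_preimage A hA
  obtain ⟨B', hB', hB2⟩ := (continuous_quotMap E X.carrier).isOpen_preimage B hB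
  have hmem : ∀ w : E.reg X.carrier, w.1 ∈ U := fun w => ((Set.ext_iff.1 hUX w.1).1 w.2).2
  have hA3 : ∀ w : E.reg X.carrier, w.1 ∈ A' ↔ E.quotMap X.carrier w ∈ A := fun w =>
    Set.ext_iff.1 hA2 w
  have hB3 : ∀ w : E.reg X.carrier, w.1 ∈ B' ↔ E.quotMap X.carrier w ∈ B := fun w =>
    Set.ext_iff.1 hB2 w
  obtain ⟨w, hw, ⟨hwA, hwU⟩, hwB, -⟩ := X.isIrreducible.isPreirreducible (A' ∩ U) (B' ∩ U)
    (hA'.inter hU) (hB'.inter hU) ⟨y, y.2.1, (hA3 y).2 hyA, hmem y⟩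
    ⟨z, z.2.1, (hB3 z).2 hzB, hmem z⟩
  have hwr : w ∈ E.reg X.carrier := by
    rw [hUX]
    exact ⟨hw, hwU⟩
  exact ⟨_, ⟨⟨w, hwr⟩, rfl⟩, (hA3 ⟨w, hwr⟩).1 hwA, (hB3 ⟨w, hwr⟩).1 hwB⟩

end LinearSemigroup

/-! ### Fields of constants and fields generated by independent elements -/

section FieldTheory

variable {k K ι : Type*} [Field k] [Field K] [Algebra k K]

/-- Elements on which commuting-coordinate derivations `∂/∂cᵢ` exist are algebraically
independent over any field of constants of these derivations, in characteristic `0`. -/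
theorem algebraicIndependent_of_derivation [CharZero K] [DecidableEq ι] {F : IntermediateField k K}
    {c : ι → K}
    (D : ι → Derivation k K K) (hF : ∀ i, ∀ a ∈ F, D i a = 0)
    (hc : ∀ i j, D i (c j) = if j = i then 1 else 0) : AlgebraicIndependent F c := by
  have hD : ∀ i (p : MvPolynomial ι F),
      D i (MvPolynomial.aeval c p) = MvPolynomial.aeval c (MvPolynomial.pderiv i p) := by
    intro i p
    induction p using MvPolynomial.induction_on with
    | C a =>
      rw [MvPolynomial.aeval_C, MvPolynomial.pderiv_C, map_zero]
      exact hF i _ a.2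
    | add p q hp hq => simp only [map_add, hp, hq]
    | mul_X p j hp =>
      rw [map_mul, Derivation.leibniz, Derivation.leibniz, hp, MvPolynomial.aeval_X, hc,
        MvPolynomial.pderiv_X]
      by_cases h : j = i
      · subst h; simp
      · simp [h]
  have : CharZero F := (algebraMap F K).charZero
  -- Induction on a strict bound for the degree: applying the derivations to a relation gives the
  -- relations ∂p/∂Xᵢ of lower degree, which vanish by induction. In characteristic 0 this leaves p
  -- constant, hence zero.
  have key : ∀ (n : ℕ) (p : MvPolynomial ι F),
      (∀ m, n ≤ m.degree → MvPolynomial.coeff m p = 0) → MvPolynomial.aeval c p = 0 → p = 0 := by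
    intro n
    induction n with
    | zero => exact fun p hp _ => MvPolynomial.ext _ _ fun m => by simpa using hp m (Nat.zero_le _)
    | succ n ih =>
      intro p hp h0
      have hd : ∀ i, MvPolynomial.pderiv i p = 0 := fun i => by
        refine ih _ (fun m hm => ?_) (by rw [← hD, h0, map_zero])
        rw [MvPolynomial.coeff_pderiv, hp _ (by simpa using hm), zero_mul]
      have hC : p = MvPolynomial.C (MvPolynomial.coeff 0 p) := by
        ext m
        by_cases hm : m = 0
        · simp [hm]
        · obtain ⟨i, hi⟩ := Finsupp.ne_iff.1 hm
          have hi' : Finsupp.single i 1 ≤ m := by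
            rw [Finsupp.single_le_iff]
            exact Nat.one_le_iff_ne_zero.2 hi
          have h1 := MvPolynomial.coeff_pderiv (i := i) p (m - Finsupp.single i 1)
          rw [hd i, tsub_add_cancel_of_le hi', MvPolynomial.coeff_zero, zero_eq_mul] at h1
          rw [h1.resolve_right (Nat.cast_add_one_ne_zero _), MvPolynomial.coeff_C,
            if_neg (Ne.symm hm)]
      rw [hC, MvPolynomial.aeval_C] at h0
      rw [hC, (map_eq_zero _).1 h0, map_zero]
  rw [algebraicIndependent_iff]
  refine fun p hp => key (p.totalDegree + 1) p (fun m hm => ?_) hp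
  exact MvPolynomial.coeff_eq_zero_of_totalDegree_lt (Nat.lt_of_succ_le hm)

section Generated

variable {F : IntermediateField k K} {M : Subalgebra k K} {c : ι → K}

/-- Independence is available over F while the coefficients must be traced back to M, so a
polynomial over M is viewed over F with a record of where its coefficients lie. -/
theorem exists_aeval_eq_of_le (hM : M ≤ F.toSubalgebra) (P : MvPolynomial ι M) :
    ∃ Q : MvPolynomial ι F, MvPolynomial.aeval c Q = MvPolynomial.aeval c P ∧
      ∀ m, ((MvPolynomial.coeff m Q : F) : K) ∈ M := by
  let j : M →+* F := (Subalgebra.inclusion hM : M →+* F.toSubalgebra)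
  refine ⟨P.map j, ?_, fun m => ?_⟩
  · rw [MvPolynomial.aeval_def, MvPolynomial.aeval_def, MvPolynomial.eval₂_map]
    rfl
  · rw [MvPolynomial.coeff_map]
    exact (MvPolynomial.coeff m P).2

/-- If `K` consists of quotients of polynomials over `M ⊆ F` in elements `c` which are
algebraically independent over `F`, then `F = M`. -/
theorem toSubalgebra_le_of_algebraicIndependent (hM : M ≤ F.toSubalgebra)
    (hinv : ∀ x ∈ M, x⁻¹ ∈ M) (hc : AlgebraicIndependent F c)
    (hgen : ∀ x : K, ∃ P Q : MvPolynomial ι M, MvPolynomial.aeval c Q ≠ 0 ∧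
      x * MvPolynomial.aeval c Q = MvPolynomial.aeval c P) : F.toSubalgebra ≤ M := by
  intro f hf
  obtain ⟨P, Q, hQ, h⟩ := hgen f
  obtain ⟨P', hP', hPM⟩ := exists_aeval_eq_of_le (c := c) hM P
  obtain ⟨Q', hQ', hQM⟩ := exists_aeval_eq_of_le (c := c) hM Q
  rw [← hQ', ← hP'] at h
  rw [← hQ'] at hQ
  have hne : Q' ≠ 0 := fun h0 => hQ (by rw [h0, map_zero])
  obtain ⟨m, hm⟩ := MvPolynomial.ne_zero_iff.1 hne
  have heq : MvPolynomial.C (⟨f, hf⟩ : F) * Q' = P' := hc (by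
    rw [map_mul, MvPolynomial.aeval_C]
    exact h)
  -- A nonzero coefficient of `Q'` exhibits f as a quotient of two elements of M.
  have h1 := congrArg (fun p => ((MvPolynomial.coeff m p : F) : K)) heq
  simp only [MvPolynomial.coeff_C_mul] at h1
  have h2 : f * ((MvPolynomial.coeff m Q' : F) : K) = ((MvPolynomial.coeff m P' : F) : K) := h1
  have h3 : ((MvPolynomial.coeff m Q' : F) : K) ≠ 0 := fun h => hm (Subtype.ext h)
  rw [(eq_mul_inv_iff_mul_eq₀ h3).2 h2]
  exact M.mul_mem (hPM m) (hinv _ (hQM m))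

theorem isTranscendenceBasis_of_generated (hM : M ≤ F.toSubalgebra)
    (hc : AlgebraicIndependent F c)
    (hgen : ∀ x : K, ∃ P Q : MvPolynomial ι M, MvPolynomial.aeval c Q ≠ 0 ∧
      x * MvPolynomial.aeval c Q = MvPolynomial.aeval c P) : IsTranscendenceBasis F c := by
  refine isTranscendenceBasis_iff_algebraicIndependent_isAlgebraic.2 ⟨hc, ⟨fun x => ?_⟩⟩
  obtain ⟨P, Q, hQ, h⟩ := hgen x
  obtain ⟨P', hP', -⟩ := exists_aeval_eq_of_le (c := c) hM P
  obtain ⟨Q', hQ', -⟩ := exists_aeval_eq_of_le (c := c) hM Q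
  have halg : ∀ p : MvPolynomial ι F,
      IsAlgebraic (Algebra.adjoin F (Set.range c)) (MvPolynomial.aeval c p) := fun p => by
    have hp : MvPolynomial.aeval c p ∈ Algebra.adjoin F (Set.range c) := by
      rw [Algebra.adjoin_range_eq_range_aeval]
      exact ⟨p, rfl⟩
    exact isAlgebraic_algebraMap (A := K)
      (⟨_, hp⟩ : Algebra.adjoin F (Set.range c))
  rw [(eq_mul_inv_iff_mul_eq₀ hQ).2 h, ← hP', ← hQ']
  exact (halg P').mul (halg Q').inv

end Generated

end FieldTheory

/-! ### Rational functions on the closure of the image and their pullbacks -/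

instance {k V : Type*} [Field k] [AddCommGroup V] [Module k V] (S : Set V) [Nonempty S] :
    Nontrivial (CoordRing k S) :=
  ⟨0, 1, fun h => by simpa using congrArg (evalAt (Classical.arbitrary S)) h⟩

theorem toFrac_eq_toFrac_iff {k W : Type*} [Field k] [AddCommGroup W] [Module k W]
    {Z : Set (ℙ k W)} {a b : regFun k W} :
    toFrac k Z a = toFrac k Z b ↔ restr k (affineCone k Z) a = restr k (affineCone k Z) b :=
  (IsLocalization.injective (HomogFrac k Z)
    (le_refl (nonZeroDivisors (HomogCoordRing k Z)))).eq_iff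

namespace LinearSemigroup

variable {k V : Type*} [Field k] [AddCommGroup V] [Module k V] [FiniteDimensional k V]
  {E : LinearSemigroup k V} {X : IrredSubvariety k V}

/-- The closure of the image of `x ↦ E(x)` in projective space. -/
abbrev quotClosure (E : LinearSemigroup k V) (S : Set V) : Set (ℙ k (⋀[k]^(E.d S) V)) :=
  plucker (E.d S) '' closure (Set.range (E.quotMap S))

/-- Pulling back regular functions on the exterior power to rational functions on `X`. -/
def pullFrac (X : IrredSubvariety k V) {d : ℕ} (φ : Fin d → E.toSubmodule) :
    regFun k (⋀[k]^d V) →ₐ[k] X.functionField :=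
  (IsScalarTower.toAlgHom k X.coordRing X.functionField).comp (pullbackOn X.carrier φ)

theorem pullFrac_apply {d : ℕ} (φ : Fin d → E.toSubmodule) (f : regFun k (⋀[k]^d V)) :
    pullFrac X φ f = algebraMap X.coordRing X.functionField (pullbackOn X.carrier φ f) := rfl

theorem pullFrac_eq_iff {d : ℕ} {φ : Fin d → E.toSubmodule} {f g : regFun k (⋀[k]^d V)} :
    pullFrac X φ f = pullFrac X φ g ↔ pullbackOn X.carrier φ f = pullbackOn X.carrier φ g :=
  (IsFractionRing.injective X.coordRing X.functionField).eq_iff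

theorem pullFrac_eq_zero_iff {d : ℕ} {φ : Fin d → E.toSubmodule} {f : regFun k (⋀[k]^d V)} :
    pullFrac X φ f = 0 ↔ pullbackOn X.carrier φ f = 0 := by
  rw [← map_zero (pullFrac X φ), pullFrac_eq_iff, map_zero]

variable {φ : Fin (E.d X.carrier) → E.toSubmodule}

theorem pullFrac_eq_of_toFrac_eq {a b : regFun k (⋀[k]^(E.d X.carrier) V)}
    (h : toFrac k (E.quotClosure X.carrier) a = toFrac k (E.quotClosure X.carrier) b) :
    pullFrac X φ a = pullFrac X φ b := by
  refine pullFrac_eq_iff.2 (coordRing_ext fun x => ?_)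
  have hx := wedge_mem_affineCone (φ := φ) x.2 1
  rw [one_smul] at hx
  exact congrArg (evalAt ⟨_, hx⟩) (toFrac_eq_toFrac_iff.1 h)

/-- The pullback of a rational function on the closure of the image of the quotient map. -/
def ratPullbackFun (φ : Fin (E.d X.carrier) → E.toSubmodule)
    (r : projFunctionField k (E.quotClosure X.carrier)) : X.functionField :=
  pullFrac X φ r.2.choose_spec.choose / pullFrac X φ r.2.choose_spec.choose_spec.choose

theorem exists_ratPullbackFun_eq (φ : Fin (E.d X.carrier) → E.toSubmodule)
    (r : projFunctionField k (E.quotClosure X.carrier)) :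
    ∃ (m : ℕ) (a b : regFun k (⋀[k]^(E.d X.carrier) V)), IsHomog k m b ∧
      restr k (affineCone k (E.quotClosure X.carrier)) b ∈
        nonZeroDivisors (HomogCoordRing k (E.quotClosure X.carrier)) ∧
      r.1 * toFrac k (E.quotClosure X.carrier) b = toFrac k (E.quotClosure X.carrier) a ∧
      ratPullbackFun φ r = pullFrac X φ a / pullFrac X φ b :=
  have h := r.2.choose_spec.choose_spec.choose_spec
  ⟨_, _, _, h.2.1, h.2.2.1, h.2.2.2, rfl⟩

variable [Infinite k]

/-- A homogeneous function whose pullback to `X` is zero vanishes on the cone over the closure of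
the image of the quotient map. -/
theorem restr_eq_zero_of_pullFrac_eq_zero {x₀ : V} (hx₀ : x₀ ∈ X.carrier) (h₀ : wedge φ x₀ ≠ 0)
    {m : ℕ} {b : regFun k (⋀[k]^(E.d X.carrier) V)} (hb : IsHomog k m b)
    (h : pullFrac X φ b = 0) :
    restr k (affineCone k (E.quotClosure X.carrier)) b = 0 := by
  refine coordRing_ext fun w => ?_
  rw [evalAt_restr, map_zero]
  refine apply_eq_zero_of_mem_affineCone hx₀ h₀ (fun t _ x hx => ?_) w.2
  have : b.1 (wedge φ x) = 0 := congrArg (evalAt ⟨x, hx⟩) (pullFrac_eq_zero_iff.1 h)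
  rw [hb, this, mul_zero]

/-- O(X) is a domain and functions on the cone are detected on multiples of multivectors, so
admissible denominators upstairs and downstairs correspond. -/
theorem pullFrac_ne_zero_iff {x₀ : V} (hx₀ : x₀ ∈ X.carrier) (h₀ : wedge φ x₀ ≠ 0)
    {m : ℕ} {b : regFun k (⋀[k]^(E.d X.carrier) V)} (hb : IsHomog k m b) :
    pullFrac X φ b ≠ 0 ↔ restr k (affineCone k (E.quotClosure X.carrier)) b ∈
      nonZeroDivisors (HomogCoordRing k (E.quotClosure X.carrier)) := by
  constructor
  · intro h
    rw [mem_nonZeroDivisors_iff_right]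
    intro g hg
    obtain ⟨g, rfl⟩ := restr_surjective k _ g
    refine coordRing_ext fun w => ?_
    rw [evalAt_restr, map_zero]
    refine apply_eq_zero_of_mem_affineCone hx₀ h₀ (fun t ht x hx => ?_) w.2
    -- The annihilated `g` need not be homogeneous, so each dilate of it is pulled back separately.
    let gt : regFun k (⋀[k]^(E.d X.carrier) V) :=
      ⟨g.1 ∘ fun w => t • w, regFun_comp (fun l => dual_mem_regFun (l.comp
        (LinearMap.lsmul k _ t))) g.2⟩
    have h1 : pullFrac X φ gt * pullFrac X φ b = 0 := by
      rw [← map_mul, pullFrac_eq_zero_iff]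
      refine coordRing_ext fun y => ?_
      have h2 : g.1 (t • wedge φ y.1) * b.1 (t • wedge φ y.1) = 0 :=
        congrArg (evalAt ⟨_, wedge_mem_affineCone (φ := φ) y.2 t⟩) hg
      rw [hb] at h2
      change g.1 (t • wedge φ y.1) * b.1 (wedge φ y.1) = 0
      simpa [ht] using h2
    exact congrArg (evalAt ⟨x, hx⟩) (pullFrac_eq_zero_iff.1 ((mul_eq_zero.1 h1).resolve_right h))
  · intro h h2
    rw [restr_eq_zero_of_pullFrac_eq_zero hx₀ h₀ hb h2] at h
    have : Nonempty (affineCone k (E.quotClosure X.carrier)) :=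
      ⟨⟨_, wedge_mem_affineCone (φ := φ) hx₀ 1⟩⟩
    exact zero_notMem_nonZeroDivisors h

/-- Two fractions representing r cross-multiply to an identity on the cone, which pulls back to X.
The pullback thus does not depend on the chosen fraction. -/
theorem ratPullbackFun_mul {x₀ : V} (hx₀ : x₀ ∈ X.carrier) (h₀ : wedge φ x₀ ≠ 0)
    {r : projFunctionField k (E.quotClosure X.carrier)}
    {a b : regFun k (⋀[k]^(E.d X.carrier) V)}
    (h : r.1 * toFrac k (E.quotClosure X.carrier) b = toFrac k (E.quotClosure X.carrier) a) :
    ratPullbackFun φ r * pullFrac X φ b = pullFrac X φ a := by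
  obtain ⟨m, a', b', hb', hn, hr, he⟩ := exists_ratPullbackFun_eq φ r
  have hb0 := (pullFrac_ne_zero_iff hx₀ h₀ hb').2 hn
  rw [he, div_mul_eq_mul_div, div_eq_iff hb0, ← map_mul, ← map_mul]
  apply pullFrac_eq_of_toFrac_eq
  rw [map_mul, map_mul, ← hr, ← h]
  ring

theorem ratPullbackFun_eq {x₀ : V} (hx₀ : x₀ ∈ X.carrier) (h₀ : wedge φ x₀ ≠ 0)
    {r : projFunctionField k (E.quotClosure X.carrier)}
    {a b : regFun k (⋀[k]^(E.d X.carrier) V)} (hb : pullFrac X φ b ≠ 0)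
    (h : r.1 * toFrac k (E.quotClosure X.carrier) b = toFrac k (E.quotClosure X.carrier) a) :
    ratPullbackFun φ r = pullFrac X φ a / pullFrac X φ b :=
  (eq_div_iff hb).2 (ratPullbackFun_mul hx₀ h₀ h)

theorem exists_rep {x₀ : V} (hx₀ : x₀ ∈ X.carrier) (h₀ : wedge φ x₀ ≠ 0)
    (r : projFunctionField k (E.quotClosure X.carrier)) :
    ∃ (m : ℕ) (a b : regFun k (⋀[k]^(E.d X.carrier) V)), IsHomog k m a ∧ IsHomog k m b ∧
      pullFrac X φ b ≠ 0 ∧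
      r.1 * toFrac k (E.quotClosure X.carrier) b = toFrac k (E.quotClosure X.carrier) a := by
  obtain ⟨m, a, b, ha, hb, hn, h⟩ := r.2
  exact ⟨m, a, b, ha, hb, (pullFrac_ne_zero_iff hx₀ h₀ hb).2 hn, h⟩

/-- Pulling back rational functions on the closure of the image of the quotient map. -/
def ratPullback {x₀ : V} (hx₀ : x₀ ∈ X.carrier) (h₀ : wedge φ x₀ ≠ 0) :
    projFunctionField k (E.quotClosure X.carrier) →ₐ[k] X.functionField where
  toFun := ratPullbackFun φ
  map_one' := by
    rw [ratPullbackFun_eq hx₀ h₀ (a := 1) (b := 1) (by simp) (by simp)]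
    simp
  map_zero' := by
    rw [ratPullbackFun_eq hx₀ h₀ (a := 0) (b := 1) (by simp) (by simp)]
    simp
  map_mul' r s := by
    obtain ⟨m, a, b, -, -, hb, h⟩ := exists_rep hx₀ h₀ r
    obtain ⟨m', a', b', -, -, hb', h'⟩ := exists_rep hx₀ h₀ s
    rw [ratPullbackFun_eq hx₀ h₀ hb h, ratPullbackFun_eq hx₀ h₀ hb' h',
      ratPullbackFun_eq hx₀ h₀ (a := a * a') (b := b * b')
        (by rw [map_mul]; exact mul_ne_zero hb hb')
        (by rw [map_mul, map_mul, ← h, ← h', MulMemClass.coe_mul]; ring),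
      map_mul, map_mul, div_mul_div_comm]
  map_add' r s := by
    obtain ⟨m, a, b, -, -, hb, h⟩ := exists_rep hx₀ h₀ r
    obtain ⟨m', a', b', -, -, hb', h'⟩ := exists_rep hx₀ h₀ s
    rw [ratPullbackFun_eq hx₀ h₀ hb h, ratPullbackFun_eq hx₀ h₀ hb' h',
      ratPullbackFun_eq hx₀ h₀ (a := a * b' + b * a') (b := b * b')
        (by rw [map_mul]; exact mul_ne_zero hb hb')
        (by rw [map_add, map_mul, map_mul, map_mul, ← h, ← h', AddMemClass.coe_add]; ring),
      map_add, map_mul, map_mul, map_mul, div_add_div _ _ hb hb']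
  commutes' t := by
    rw [ratPullbackFun_eq hx₀ h₀ (a := algebraMap k _ t) (b := 1) (by simp)
      (by rw [map_one, mul_one, AlgHom.commutes]; rfl)]
    simp

theorem ratPullback_eq {x₀ : V} (hx₀ : x₀ ∈ X.carrier) (h₀ : wedge φ x₀ ≠ 0)
    {r : projFunctionField k (E.quotClosure X.carrier)}
    {a b : regFun k (⋀[k]^(E.d X.carrier) V)} (hb : pullFrac X φ b ≠ 0)
    (h : r.1 * toFrac k (E.quotClosure X.carrier) b = toFrac k (E.quotClosure X.carrier) a) :
    ratPullback hx₀ h₀ r = pullFrac X φ a / pullFrac X φ b :=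
  ratPullbackFun_eq hx₀ h₀ hb h

theorem mem_range_ratPullback {x₀ : V} (hx₀ : x₀ ∈ X.carrier) (h₀ : wedge φ x₀ ≠ 0)
    {f : X.functionField} :
    f ∈ (ratPullback hx₀ h₀).range ↔
      ∃ (m : ℕ) (a b : regFun k (⋀[k]^(E.d X.carrier) V)), IsHomog k m a ∧ IsHomog k m b ∧
        pullFrac X φ b ≠ 0 ∧ f = pullFrac X φ a / pullFrac X φ b := by
  constructor
  · rintro ⟨r, rfl⟩
    obtain ⟨m, a, b, ha, hb, hb0, h⟩ := exists_rep hx₀ h₀ r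
    exact ⟨m, a, b, ha, hb, hb0, ratPullback_eq hx₀ h₀ hb0 h⟩
  · rintro ⟨m, a, b, ha, hb, hb0, rfl⟩
    have hn := (pullFrac_ne_zero_iff hx₀ h₀ hb).1 hb0
    let r := IsLocalization.mk' (HomogFrac k (E.quotClosure X.carrier))
      (restr k (affineCone k (E.quotClosure X.carrier)) a) ⟨_, hn⟩
    have hr : r * toFrac k (E.quotClosure X.carrier) b = toFrac k (E.quotClosure X.carrier) a :=
      IsLocalization.mk'_spec (HomogFrac k (E.quotClosure X.carrier)) _ (⟨_, hn⟩ : nonZeroDivisors _)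
    exact ⟨⟨r, m, a, b, ha, hb, hn, hr⟩, ratPullback_eq hx₀ h₀ hb0 hr⟩

theorem inv_mem_range_ratPullback {x₀ : V} (hx₀ : x₀ ∈ X.carrier) (h₀ : wedge φ x₀ ≠ 0)
    {f : X.functionField} (hf : f ∈ (ratPullback hx₀ h₀).range) :
    f⁻¹ ∈ (ratPullback hx₀ h₀).range := by
  obtain ⟨m, a, b, ha, hb, hb0, rfl⟩ := (mem_range_ratPullback hx₀ h₀).1 hf
  by_cases ha0 : pullFrac X φ a = 0
  · rw [ha0, zero_div, inv_zero]
    exact Subalgebra.zero_mem _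
  · exact (mem_range_ratPullback hx₀ h₀).2 ⟨m, b, a, hb, ha, ha0, inv_div _ _⟩

theorem ratPullback_injective {x₀ : V} (hx₀ : x₀ ∈ X.carrier) (h₀ : wedge φ x₀ ≠ 0) :
    Function.Injective (ratPullback hx₀ h₀) := by
  refine (injective_iff_map_eq_zero _).2 fun r hr => ?_
  obtain ⟨m, a, b, ha, hb, hb0, h⟩ := exists_rep hx₀ h₀ r
  rw [ratPullback_eq hx₀ h₀ hb0 h, div_eq_zero_iff, or_iff_left hb0] at hr
  have h2 : toFrac k (E.quotClosure X.carrier) a = 0 := by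
    rw [← map_zero (toFrac k _), toFrac_eq_toFrac_iff, map_zero]
    exact restr_eq_zero_of_pullFrac_eq_zero hx₀ h₀ ha hr
  have hu : IsUnit (toFrac k (E.quotClosure X.carrier) b) :=
    IsLocalization.map_units (HomogFrac k (E.quotClosure X.carrier))
      (⟨_, (pullFrac_ne_zero_iff hx₀ h₀ hb).1 hb0⟩ : nonZeroDivisors _)
  rw [h2] at h
  exact Subtype.ext ((hu.mul_left_eq_zero).1 h)

/-- Values of pulled back rational functions. -/
theorem hasValueAt_ratPullback {x₀ : V} (hx₀ : x₀ ∈ X.carrier) (h₀ : wedge φ x₀ ≠ 0)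
    {r : projFunctionField k (E.quotClosure X.carrier)} {x : E.reg X.carrier} {c : k}
    (h : ProjHasValueAt r (plucker _ (E.quotMap X.carrier x)) c) :
    X.HasValueAt (ratPullback hx₀ h₀ r) ⟨x, x.2.1⟩ c := by
  obtain ⟨m, a, b, ha, hb, hb0, h, rfl⟩ := h
  -- The multivector of φ may vanish at x, so the value is read off from a family ψ adapted to x;
  -- cross multiplication shows that both families give the same rational function.
  obtain ⟨ψ, hψ⟩ := exists_wedge_ne_zero x.2
  obtain ⟨u, hu0, hu⟩ := exists_plucker_quotMap_rep x hψ
  rw [hu, hb] at hb0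
  refine ⟨pullbackOn X.carrier ψ a, pullbackOn X.carrier ψ b, right_ne_zero_of_mul hb0, ?_, ?_⟩
  · obtain ⟨n, a', b', -, -, hb'0, h'⟩ := exists_rep hx₀ h₀ r
    rw [ratPullback_eq hx₀ h₀ hb'0 h', div_mul_eq_mul_div, div_eq_iff hb'0, pullFrac_apply,
      pullFrac_apply, ← map_mul, ← map_mul, pullbackOn_mul_eq hx₀ h₀ ha hb]
    refine pullFrac_eq_iff.1 (pullFrac_eq_of_toFrac_eq ?_)
    rw [map_mul, map_mul, ← h, ← h']
    ring
  · rw [hu, ha, hb, evalAt_pullbackOn, evalAt_pullbackOn,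
      mul_div_mul_left _ _ (pow_ne_zero m hu0)]

end LinearSemigroup

namespace LinearSemigroup

variable {k V : Type*} [Field k] [AddCommGroup V] [Module k V] [FiniteDimensional k V]
  {E : LinearSemigroup k V} {X : IrredSubvariety k V} {φ : Fin (E.d X.carrier) → E.toSubmodule}

/-! ### Pullbacks are first integrals -/

section Derivations

variable [Infinite k]

/-- Along a vector field of `E`, the pullback of a homogeneous function changes by a factor
depending only on its degree. -/
theorem exists_dirDeriv_pullback_eq {χ : V → V}
    (hχ : χ ∈ E.toSubmodule) {x : V} (hx : x ∈ X.carrier) (h : wedge φ x ≠ 0) :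
    ∃ q : ℕ → k, ∀ (m : ℕ) (a : regFun k (⋀[k]^(E.d X.carrier) V)), IsHomog k m a →
      dirDeriv k (pullback φ a).1 x (χ x) = a.1 (wedge φ x) * q m := by
  obtain ⟨l, hl⟩ := Module.Projective.exists_dual_eq_one k h
  obtain ⟨p, hp⟩ := exists_poly (pullback φ ⟨l, dual_mem_regFun l⟩).2 x (χ x)
  refine ⟨fun m => (p ^ m).derivative.eval 0, fun m a ha => ?_⟩
  -- The point x + tχ(x) stays in E(x), so the multivector is rescaled. Since `l` is 1 on the
  -- multivector at x, the factor is the polynomial `p`.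
  have hw : ∀ t : k, wedge φ (x + t • χ x) = p.eval t • wedge φ x := by
    intro t
    obtain ⟨c, hc⟩ := exists_wedge_eq_smul (ψ := φ) hx
      (Submodule.add_mem _ (self_mem_orbit x)
        (Submodule.smul_mem _ t (apply_mem_orbit hχ x))) h
    have h2 : p.eval t = c := by
      rw [hp t]
      change l (wedge φ (x + t • χ x)) = c
      rw [hc, map_smul, hl, smul_eq_mul, mul_one]
    rw [hc, h2]
  rw [dirDeriv_eq (p := Polynomial.C (a.1 (wedge φ x)) * p ^ m) (fun t => by
    rw [pullback_apply, hw, ha]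
    simp [mul_comm])]
  rw [Polynomial.derivative_C_mul, Polynomial.eval_C_mul]

theorem vectorFieldOn_pullbackOn_mul (hX : E.Stable X.carrier) {χ : V → V}
    (hχ : χ ∈ E.toSubmodule) {x₀ : V} (hx₀ : x₀ ∈ X.carrier) (h₀ : wedge φ x₀ ≠ 0)
    {m : ℕ} {a b : regFun k (⋀[k]^(E.d X.carrier) V)} (ha : IsHomog k m a) (hb : IsHomog k m b) :
    vectorFieldOn hX χ hχ (pullbackOn X.carrier φ a) * pullbackOn X.carrier φ b =
      pullbackOn X.carrier φ a * vectorFieldOn hX χ hχ (pullbackOn X.carrier φ b) := by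
  refine coordRing_ext_of_wedge hx₀ h₀ fun x hx => ?_
  obtain ⟨q, hq⟩ := exists_dirDeriv_pullback_eq hχ x.2 hx
  have h : ∀ f, IsHomog k m f → evalAt x (vectorFieldOn hX χ hχ (pullbackOn X.carrier φ f)) =
      f.1 (wedge φ x) * q m := fun f hf => by
    rw [pullbackOn, AlgHom.comp_apply, vectorFieldOn_restr]
    exact hq m f hf
  rw [map_mul, map_mul, h a ha, h b hb, evalAt_pullbackOn, evalAt_pullbackOn]
  ring

theorem range_ratPullback_le (hX : E.Stable X.carrier) {x₀ : V} (hx₀ : x₀ ∈ X.carrier)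
    (h₀ : wedge φ x₀ ≠ 0) :
    (ratPullback hx₀ h₀).range ≤ (E.firstIntegrals X hX).toSubalgebra := by
  intro f hf
  obtain ⟨m, a, b, ha, hb, hb0, h⟩ := (mem_range_ratPullback hx₀ h₀).1 hf
  intro χ hχ
  have h1 := congrArg (algebraMap X.coordRing X.functionField)
    (vectorFieldOn_pullbackOn_mul hX hχ hx₀ h₀ ha hb)
  rw [map_mul, map_mul, ← fracDeriv_algebraMap, ← fracDeriv_algebraMap] at h1
  rw [eq_div_iff hb0] at h
  have h2 := congrArg (fracDeriv X.functionField (vectorFieldOn hX χ hχ)) h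
  rw [Derivation.leibniz, smul_eq_mul, smul_eq_mul] at h2
  simp only [← pullFrac_apply] at h1
  -- The quotient rule cleared of denominators: with f = a/b, b²·ξf = b·ξa − a·ξb = 0.
  have h3 : pullFrac X φ b * (pullFrac X φ b *
      fracDeriv X.functionField (vectorFieldOn hX χ hχ) f) = 0 := by
    linear_combination pullFrac X φ b * h2 + h1 -
      fracDeriv X.functionField (vectorFieldOn hX χ hχ) (pullFrac X φ b) * h
  exact (mul_eq_zero.1 ((mul_eq_zero.1 h3).resolve_left hb0)).resolve_left hb0

end Derivations

/-! ### Generating k(X) by linear forms; first integrals and dimension -/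

section Coordinates

/-- The rational function on `X` defined by a linear form. -/
def linFrac (X : IrredSubvariety k V) (l : Module.Dual k V) : X.functionField :=
  algebraMap X.coordRing X.functionField (restr k X.carrier ⟨l, dual_mem_regFun l⟩)

omit [FiniteDimensional k V] in
theorem exists_aeval_eq_algebraMap_restr {ι : Type*} {M : Subalgebra k X.functionField}
    {c : ι → X.functionField}
    (h : ∀ l : Module.Dual k V, ∃ P : MvPolynomial ι M, MvPolynomial.aeval c P = linFrac X l)
    (g : regFun k V) : ∃ P : MvPolynomial ι M, MvPolynomial.aeval c P =
      algebraMap X.coordRing X.functionField (restr k X.carrier g) := by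
  obtain ⟨g, hg⟩ := g
  induction hg using Algebra.adjoin_induction with
  | mem g hg =>
    obtain ⟨l, rfl⟩ := hg
    exact h l
  | algebraMap t =>
    refine ⟨MvPolynomial.C (algebraMap k _ t), ?_⟩
    rw [MvPolynomial.aeval_C]
    exact (IsScalarTower.algebraMap_apply k X.coordRing X.functionField t)
  | add f g hf' hg' hf hg =>
    obtain ⟨P, hP⟩ := hf
    obtain ⟨Q, hQ⟩ := hg
    exact ⟨P + Q, by rw [map_add, hP, hQ, ← map_add, ← map_add]; rfl⟩
  | mul f g hf' hg' hf hg =>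
    obtain ⟨P, hP⟩ := hf
    obtain ⟨Q, hQ⟩ := hg
    exact ⟨P * Q, by rw [map_mul, hP, hQ, ← map_mul, ← map_mul]; rfl⟩

omit [FiniteDimensional k V] in
theorem exists_mul_aeval_eq {ι : Type*} {M : Subalgebra k X.functionField}
    {c : ι → X.functionField}
    (h : ∀ l : Module.Dual k V, ∃ P : MvPolynomial ι M, MvPolynomial.aeval c P = linFrac X l)
    (f : X.functionField) : ∃ P Q : MvPolynomial ι M, MvPolynomial.aeval c Q ≠ 0 ∧
      f * MvPolynomial.aeval c Q = MvPolynomial.aeval c P := by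
  obtain ⟨a, b, hb, rfl⟩ := IsFractionRing.div_surjective X.coordRing f
  obtain ⟨a, rfl⟩ := restr_surjective k _ a
  obtain ⟨b, rfl⟩ := restr_surjective k _ b
  obtain ⟨P, hP⟩ := exists_aeval_eq_algebraMap_restr h a
  obtain ⟨Q, hQ⟩ := exists_aeval_eq_algebraMap_restr h b
  have hb0 : algebraMap X.coordRing X.functionField (restr k X.carrier b) ≠ 0 :=
    IsFractionRing.to_map_ne_zero_of_mem_nonZeroDivisors hb
  exact ⟨P, Q, by rw [hQ]; exact hb0, by rw [hP, hQ]; exact div_mul_cancel₀ _ hb0⟩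

/-- Cramer's rule at the generic point of `X`. -/
theorem pullFrac_detForm_mul_linFrac {x₀ : V} (hx₀ : x₀ ∈ X.carrier) (h₀ : wedge φ x₀ ≠ 0)
    (s : Fin (E.d X.carrier) → Module.Dual k V) (l : Module.Dual k V) :
    pullFrac X φ ⟨detForm s, dual_mem_regFun _⟩ * linFrac X l =
      ∑ i, pullFrac X φ ⟨detForm (Function.update s i l), dual_mem_regFun _⟩ *
        linFrac X (s i) := by
  simp only [pullFrac_apply, linFrac, ← map_mul, ← map_sum]
  congr 1
  refine coordRing_ext_of_wedge hx₀ h₀ fun x hx => ?_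
  rw [map_mul, map_sum]
  simp only [map_mul, evalAt_restr, evalAt_pullbackOn]
  refine detForm_mul_eq_sum s l ?_
  rw [span_eq_orbit x.2 (iotaMulti_ne_zero_iff.1 hx)]
  exact self_mem_orbit x.1

theorem pullFrac_ne_zero {d : ℕ} {φ : Fin d → E.toSubmodule} {x₀ : V} (hx₀ : x₀ ∈ X.carrier)
    {f : regFun k (⋀[k]^d V)} (hf : f.1 (wedge φ x₀) ≠ 0) : pullFrac X φ f ≠ 0 := fun h =>
  hf (congrArg (evalAt ⟨x₀, hx₀⟩) (pullFrac_eq_zero_iff.1 h))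

variable [Infinite k] {s : Fin (E.d X.carrier) → Module.Dual k V}

/-- The coefficients in Cramer's rule are pulled back from the quotient. -/
theorem exists_linFrac_eq_sum {x₀ : V} (hx₀ : x₀ ∈ X.carrier) (h₀ : wedge φ x₀ ≠ 0)
    (hs : detForm s (wedge φ x₀) ≠ 0) (l : Module.Dual k V) :
    ∃ r : Fin (E.d X.carrier) → (ratPullback hx₀ h₀).range,
      linFrac X l = ∑ i, (r i : X.functionField) * linFrac X (s i) := by
  have hne : pullFrac X φ ⟨detForm s, dual_mem_regFun _⟩ ≠ 0 := pullFrac_ne_zero hx₀ hs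
  refine ⟨fun i => ⟨pullFrac X φ ⟨detForm (Function.update s i l), dual_mem_regFun _⟩ /
    pullFrac X φ ⟨detForm s, dual_mem_regFun _⟩, (mem_range_ratPullback hx₀ h₀).2
      ⟨1, _, _, isHomog_dual _, isHomog_dual _, hne, rfl⟩⟩, ?_⟩
  refine mul_left_cancel₀ hne ?_
  rw [pullFrac_detForm_mul_linFrac hx₀ h₀, Finset.mul_sum]
  refine Finset.sum_congr rfl fun i _ => ?_
  rw [← mul_assoc, mul_div_cancel₀ _ hne]

theorem exists_mul_aeval_linFrac_eq {x₀ : V} (hx₀ : x₀ ∈ X.carrier) (h₀ : wedge φ x₀ ≠ 0)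
    (hs : detForm s (wedge φ x₀) ≠ 0) (f : X.functionField) :
    ∃ P Q : MvPolynomial (Fin (E.d X.carrier)) (ratPullback hx₀ h₀).range,
      MvPolynomial.aeval (fun i => linFrac X (s i)) Q ≠ 0 ∧
      f * MvPolynomial.aeval (fun i => linFrac X (s i)) Q =
        MvPolynomial.aeval (fun i => linFrac X (s i)) P := by
  refine exists_mul_aeval_eq (fun l => ?_) f
  obtain ⟨r, hr⟩ := exists_linFrac_eq_sum hx₀ h₀ hs l
  refine ⟨∑ i, MvPolynomial.C (r i) * MvPolynomial.X i, ?_⟩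
  rw [hr, map_sum]
  refine Finset.sum_congr rfl fun i _ => ?_
  rw [map_mul, MvPolynomial.aeval_C, MvPolynomial.aeval_X]
  rfl

-- The functions ξ_{φⱼ} sᵢ = sᵢ(φⱼ) form a matrix whose determinant is nonzero at x₀. Its inverse
-- over k(X) turns the ξ_{φⱼ} into derivations dual to the sᵢ, which still kill the first integrals.
omit [FiniteDimensional k V] in
theorem algebraicIndependent_linFrac [CharZero k] (hX : E.Stable X.carrier) {x₀ : V}
    (hx₀ : x₀ ∈ X.carrier) (hs : detForm s (wedge φ x₀) ≠ 0) :
    AlgebraicIndependent (E.firstIntegrals X hX) (fun i => linFrac X (s i)) := by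
  have : CharZero X.functionField :=
    charZero_of_injective_algebraMap (algebraMap k X.functionField).injective
  let N₀ : Matrix (Fin (E.d X.carrier)) (Fin (E.d X.carrier)) X.coordRing := Matrix.of fun j i =>
    restr k X.carrier ⟨fun v => s i ((φ j).1 v), E.isPolyMap _ (φ j).2 (s i)⟩
  let N := (algebraMap X.coordRing X.functionField).mapMatrix N₀
  have hN₀ : N₀.det ≠ 0 := fun h => hs (by
    have h2 := congrArg (evalAt ⟨x₀, hx₀⟩) h
    rw [AlgHom.map_det, map_zero] at h2
    rw [wedge, detForm_iotaMulti, ← Matrix.det_transpose]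
    exact h2)
  have hN : IsUnit N.det := by
    rw [← RingHom.map_det, isUnit_iff_ne_zero, Ne,
      FaithfulSMul.algebraMap_eq_zero_iff]
    exact hN₀
  have hD : ∀ i j, fracDeriv X.functionField (vectorFieldOn hX (φ j).1 (φ j).2)
      (linFrac X (s i)) = N j i := fun i j => by
    rw [linFrac, fracDeriv_algebraMap, vectorFieldOn_restr]
    change algebraMap X.coordRing X.functionField _ = algebraMap X.coordRing X.functionField _
    congr 2
    exact Subtype.ext (funext fun v => dirDeriv_linear _ _ _)
  have hsum : ∀ (g : Fin (E.d X.carrier) → Derivation k X.functionField X.functionField)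
      (f : X.functionField), (∑ j, g j) f = ∑ j, g j f := fun g f => by
    have := congrFun (map_sum Derivation.coeFnAddMonoidHom g Finset.univ) f
    rwa [Finset.sum_apply] at this
  refine algebraicIndependent_of_derivation (fun i => ∑ j, N⁻¹ i j •
    fracDeriv X.functionField (vectorFieldOn hX (φ j).1 (φ j).2)) (fun i a ha => ?_)
    fun i a => ?_
  · rw [hsum]
    exact Finset.sum_eq_zero fun j _ => by
      rw [Derivation.smul_apply, ha _ (φ j).2, smul_zero]
  · rw [hsum]
    simp only [Derivation.smul_apply, hD, smul_eq_mul]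
    have := congrFun (congrFun (Matrix.nonsing_inv_mul N hN) i) a
    rw [Matrix.mul_apply, Matrix.one_apply] at this
    rw [this]
    simp only [eq_comm]

theorem range_ratPullback_eq [CharZero k] (hX : E.Stable X.carrier) {x₀ : V}
    (hx₀ : x₀ ∈ X.carrier) (h₀ : wedge φ x₀ ≠ 0) :
    (ratPullback hx₀ h₀).range = (E.firstIntegrals X hX).toSubalgebra := by
  obtain ⟨s, hs⟩ := exists_detForm_ne_zero (iotaMulti_ne_zero_iff.1 h₀)
  exact (range_ratPullback_le hX hx₀ h₀).antisymm
    (toSubalgebra_le_of_algebraicIndependent (range_ratPullback_le hX hx₀ h₀)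
      (fun x hx => inv_mem_range_ratPullback hx₀ h₀ hx)
      (algebraicIndependent_linFrac hX hx₀ hs) (exists_mul_aeval_linFrac_eq hx₀ h₀ hs))

theorem trdeg_firstIntegrals_functionField [CharZero k] (hX : E.Stable X.carrier) {x₀ : V}
    (hx₀ : x₀ ∈ X.carrier) (h₀ : wedge φ x₀ ≠ 0) :
    Algebra.trdeg (E.firstIntegrals X hX) X.functionField = E.d X.carrier := by
  obtain ⟨s, hs⟩ := exists_detForm_ne_zero (iotaMulti_ne_zero_iff.1 h₀)
  have := (isTranscendenceBasis_of_generated (range_ratPullback_le hX hx₀ h₀)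
    (algebraicIndependent_linFrac hX hx₀ hs)
    (exists_mul_aeval_linFrac_eq hx₀ h₀ hs)).lift_cardinalMk_eq_trdeg
  simpa using this.symm

theorem trdeg_firstIntegrals_add_d [CharZero k] (hX : E.Stable X.carrier) {x₀ : V}
    (hx₀ : x₀ ∈ X.carrier) (h₀ : wedge φ x₀ ≠ 0) :
    Algebra.trdeg k (E.firstIntegrals X hX) + E.d X.carrier = X.dim := by
  rw [← trdeg_firstIntegrals_functionField hX hx₀ h₀, IrredSubvariety.dim]
  exact trdeg_add_eq k (E.firstIntegrals X hX) (A := X.functionField)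

/-- Pulling back rational functions as an isomorphism onto the field of first integrals. -/
def ratPullbackEquiv [CharZero k] (hX : E.Stable X.carrier) {x₀ : V}
    (hx₀ : x₀ ∈ X.carrier) (h₀ : wedge φ x₀ ≠ 0) :
    projFunctionField k (E.quotClosure X.carrier) ≃ₐ[k] E.firstIntegrals X hX :=
  (AlgEquiv.ofInjective (ratPullback hx₀ h₀) (ratPullback_injective hx₀ h₀)).trans
    (Subalgebra.equivOfEq _ _ (range_ratPullback_eq hX hx₀ h₀))

theorem coe_ratPullbackEquiv [CharZero k] (hX : E.Stable X.carrier) {x₀ : V}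
    (hx₀ : x₀ ∈ X.carrier) (h₀ : wedge φ x₀ ≠ 0)
    (r : projFunctionField k (E.quotClosure X.carrier)) :
    (ratPullbackEquiv hX hx₀ h₀ r : X.functionField) = ratPullback hx₀ h₀ r := rfl

theorem firstIntegrals_eq_bot_iff [IsAlgClosed k] [CharZero k] (hX : E.Stable X.carrier) {x₀ : V}
    (hx₀ : x₀ ∈ X.carrier) (h₀ : wedge φ x₀ ≠ 0) :
    E.firstIntegrals X hX = ⊥ ↔ (E.d X.carrier : Cardinal) = X.dim := by
  rw [← trdeg_firstIntegrals_add_d hX hx₀ h₀]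
  constructor
  · intro h
    rw [h, trdeg_eq_zero, zero_add]
  · intro h
    -- Cancellation of cardinals is legitimate because d(X) is finite.
    have h0 : Algebra.trdeg k (E.firstIntegrals X hX) = 0 :=
      Cardinal.eq_of_add_eq_add_right (b := (E.d X.carrier : Cardinal))
        (by rw [zero_add, ← h]) (Cardinal.natCast_lt_aleph0)
    have halg := (trdeg_eq_zero_iff).1 h0
    refine eq_bot_iff.2 fun f hf => ?_
    obtain ⟨t, ht⟩ := (IsAlgClosed.algebraMap_bijective_of_isIntegral
      (k := k) (K := E.firstIntegrals X hX)).2 ⟨f, hf⟩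
    exact IntermediateField.mem_bot.2 ⟨t, congrArg Subtype.val ht⟩

/-- If all first integrals are constant, then the variety is a linear subspace. -/
theorem exists_eq_submodule [CharZero k] (hX : E.Stable X.carrier) {x₀ : V}
    (hx₀ : x₀ ∈ X.carrier) (h₀ : wedge φ x₀ ≠ 0) (h : E.firstIntegrals X hX = ⊥) :
    ∃ L : Submodule k V, X.carrier = L := by
  obtain ⟨s, hs⟩ := exists_detForm_ne_zero (iotaMulti_ne_zero_iff.1 h₀)
  have hl : ∀ l : Module.Dual k V, ∃ t : Fin (E.d X.carrier) → k, ∀ x ∈ X.carrier,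
      l x = ∑ i, t i * s i x := by
    intro l
    obtain ⟨r, hr⟩ := exists_linFrac_eq_sum hx₀ h₀ hs l
    have hr2 : ∀ i, ∃ t : k, algebraMap k X.functionField t = r i := fun i => by
      have h1 : (r i : X.functionField) ∈ E.firstIntegrals X hX :=
        range_ratPullback_le hX hx₀ h₀ (r i).2
      rw [h] at h1
      exact IntermediateField.mem_bot.1 h1
    choose t ht using hr2
    refine ⟨t, fun x hx => ?_⟩
    simp only [← ht, linFrac, IsScalarTower.algebraMap_apply k X.coordRing X.functionField,
      ← map_mul, ← map_sum] at hr
    have h2 := congrArg (evalAt ⟨x, hx⟩) (IsFractionRing.injective X.coordRing X.functionField hr)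
    simpa [evalAt_restr] using h2
  -- On the span of X every linear form is a constant combination of the d(X) forms `s i`, so these
  -- separate its vectors and bound its dimension by d(X).
  have hinj : ∀ v ∈ Submodule.span k X.carrier, LinearMap.pi s v = 0 → v = 0 := by
    intro v hv h0
    refine (Module.forall_dual_apply_eq_zero_iff k v).1 fun l => ?_
    obtain ⟨t, ht⟩ := hl l
    have : l v = ∑ i, t i * s i v := by
      clear h0
      induction hv using Submodule.span_induction with
      | mem x hx => exact ht x hx
      | zero => simp
      | add a b _ _ ha hb => simp only [map_add, mul_add, ha, hb, Finset.sum_add_distrib]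
      | smul c a _ ha =>
        simp only [map_smul, smul_eq_mul, mul_left_comm _ c, ha, Finset.mul_sum]
    rw [this]
    exact Finset.sum_eq_zero fun i _ => by
      rw [show s i v = 0 from congrFun h0 i, mul_zero]
  have hle : E.orbit x₀ ≤ Submodule.span k X.carrier := fun y hy =>
    Submodule.subset_span (orbit_subset hX hx₀ hy)
  have hfin : Module.finrank k (Submodule.span k X.carrier) ≤ E.d X.carrier := by
    have := LinearMap.finrank_le_finrank_of_injective
      (f := (LinearMap.pi s).comp (Submodule.span k X.carrier).subtype)
      ((injective_iff_map_eq_zero _).2 fun v hv => Subtype.ext (hinj v v.2 hv))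
    simpa using this
  have heq := Submodule.eq_of_le_of_finrank_le hle
    (hfin.trans (mem_reg_of_wedge_ne_zero hx₀ h₀).2.ge)
  refine ⟨E.orbit x₀, (orbit_subset hX hx₀).antisymm' ?_⟩
  rw [heq]
  exact Submodule.subset_span

end Coordinates

end LinearSemigroup

end LinSemi

end

open LinSemi
theorem mainTheorem3 {k V : Type*} [Field k] [IsAlgClosed k] [CharZero k] [AddCommGroup V]
    [Module k V] [FiniteDimensional k V] (E : LinearSemigroup k V) (X : IrredSubvariety k V)
    (hX : E.Stable X.carrier) :
    -- the fibres of `π`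
    (∀ x : E.reg X.carrier,
      (Subtype.val '' (E.quotMap X.carrier ⁻¹' {E.quotMap X.carrier x}) : Set V) =
        (E.orbit x : Set V) ∩ E.reg X.carrier) ∧
    -- the closure of the image of `π` is irreducible, and pulling back rational functions
    -- along `π` is an isomorphism onto the field of first integrals
    IsIrreducible (closure (Set.range (E.quotMap X.carrier))) ∧
    (∃ Φ : grFunctionField (closure (Set.range (E.quotMap X.carrier))) ≃ₐ[k]
        E.firstIntegrals X hX,
      ∀ (r : grFunctionField (closure (Set.range (E.quotMap X.carrier))))
        (x : E.reg X.carrier) (c : k),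
        ProjHasValueAt r (plucker _ (E.quotMap X.carrier x)) c →
          X.HasValueAt (Φ r) ⟨x, x.2.1⟩ c) ∧
    -- transcendence degree and dimension
    Algebra.trdeg k (E.firstIntegrals X hX) + E.d X.carrier = X.dim ∧
    Algebra.trdeg k (E.firstIntegrals X hX) =
      grDim (closure (Set.range (E.quotMap X.carrier))) ∧
    -- the case without non-constant first integrals
    (E.firstIntegrals X hX = ⊥ ↔ (E.d X.carrier : Cardinal) = X.dim) ∧
    ((E.d X.carrier : Cardinal) = X.dim → ∃ L : Submodule k V, X.carrier = L) := by
  obtain ⟨x₀, hx₀⟩ := LinearSemigroup.reg_nonempty E X.isIrreducible.1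
  obtain ⟨φ, h₀⟩ := LinearSemigroup.exists_wedge_ne_zero hx₀
  refine ⟨LinearSemigroup.image_quotMap_fibre,
    LinearSemigroup.isIrreducible_closure_range_quotMap E X,
    ⟨LinearSemigroup.ratPullbackEquiv hX hx₀.1 h₀, fun r x c h => ?_⟩,
    LinearSemigroup.trdeg_firstIntegrals_add_d hX hx₀.1 h₀,
    (LinearSemigroup.ratPullbackEquiv hX hx₀.1 h₀).trdeg_eq.symm,
    LinearSemigroup.firstIntegrals_eq_bot_iff hX hx₀.1 h₀,
    fun h => LinearSemigroup.exists_eq_submodule hX hx₀.1 h₀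
      ((LinearSemigroup.firstIntegrals_eq_bot_iff hX hx₀.1 h₀).2 h)⟩
  rw [LinearSemigroup.coe_ratPullbackEquiv]
  exact LinearSemigroup.hasValueAt_ratPullback hx₀.1 h₀ h
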